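/- Let $a_0,a_1,a_2,\dots$ be i.i.d. real standard Gaussian random variables and let $f(t)=\sum_{k=0}^\infty a_k t^k$; almost surely the series converges for every $t\in(-1,1)$. For $s,t\in(-1,1)$ put $$\sigma(s,t)=\frac1{1-st},\qquad c(s,t)=\frac{\sigma(s,t)}{\sqrt{\sigma(s,s)\sigma(t,t)}}=\frac{\sqrt{(1-s^2)(1-t^2)}}{1-st},\qquad \mathbb{K}_{22}(s,t)=\operatorname{sgn}(t-s)\arcsin c(s,t),$$ where $\operatorname{sgn}(x)=x/|x|$ for $x\neq0$ and $\operatorname{sgn}(0)=0$. For a skew-symmetric matrix $B=(b_{ij})_{i,j=1}^{2n}$ let $$\operatorname{pf}(B)=\sum_\eta \epsilon(\eta)\, b_{\eta(1)\eta(2)}b_{\eta(3)\eta(4)}\cdots b_{\eta(2n-1)\eta(2n)},$$ summed over all permutations $\eta$ of $\{1,\dots,2n\}$ with $\eta(2i-1)<\eta(2i)$ for $i=1,\dots,n$ and $\eta(1)<\eta(3)<\cdots<\eta(2n-1)$, where $\epsilon(\eta)$ is the signature of $\eta$; the Pfaffian of an array $(a_{ij})_{1\le i<j\le 2n}$ is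 that of the skew-symmetric matrix with these entries above the diagonal. For all distinct $t_1,\dots,t_{2n}\in(-1,1)$, $$E[\operatorname{sgn} f(t_1)\cdots\operatorname{sgn} f(t_{2n})]=\Bigl(\frac2\pi\Bigr)^n\prod_{1\le i<j\le 2n}\operatorname{sgn}(t_j-t_i)\cdot\operatorname{pf}\bigl(\mathbb{K}_{22}(t_i,t_j)\bigr)_{i,j=1}^{2n}.$$ In particular, if $-1<t_1<t_2<\cdots<t_{2n}<1$, then $$E[\operatorname{sgn} f(t_1)\cdots\operatorname{sgn} f(t_{2n})]=\Bigl(\frac2\pi\Bigr)^n\operatorname{pf}\bigl(\arcsin c(t_i,t_j)\bigr)_{1\le i<j\le 2n}=\operatorname{pf}\bigl(E[\operatorname{sgn} f(t_i)\operatorname{sgn} f(t_j)]\bigr)_{1\le i<j\le 2n}.$$ -/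

import Mathlib

open MeasureTheory ProbabilityTheory

noncomputable section

namespace GaussianPowerSeries

/-- The index `2 i + 1` of `{1, …, 2n}` counted from one (`2 i` counted from zero). -/
def fstIdx {n : ℕ} (i : Fin n) : Fin (2 * n) := ⟨2 * (i : ℕ), by omega⟩

/-- The index `2 i + 2` of `{1, …, 2n}` counted from one (`2 i + 1` counted from zero). -/
def sndIdx {n : ℕ} (i : Fin n) : Fin (2 * n) := ⟨2 * (i : ℕ) + 1, by omega⟩

open Classical in
/-- The Pfaffian of a skew-symmetric `2n × 2n` matrix `B`: the sum of
`ε(η) b_{η(1)η(2)} b_{η(3)η(4)} ⋯ b_{η(2n-1)η(2n)}` over the permutations `η` such that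
`η(2i-1) < η(2i)` for all `i` and `η(1) < η(3) < ⋯ < η(2n-1)`. -/
def pfaffian {n : ℕ} (B : Matrix (Fin (2 * n)) (Fin (2 * n)) ℝ) : ℝ :=
  ∑ η : Equiv.Perm (Fin (2 * n)) with
      (∀ i : Fin n, η (fstIdx i) < η (sndIdx i)) ∧ StrictMono (fun i : Fin n => η (fstIdx i)),
    ((Equiv.Perm.sign η : ℤ) : ℝ) * ∏ i : Fin n, B (η (fstIdx i)) (η (sndIdx i))

/-- The skew-symmetric matrix whose entries above the diagonal are those of the array `A`. -/
def skewOfUpper {m : ℕ} (A : Fin m → Fin m → ℝ) : Matrix (Fin m) (Fin m) ℝ :=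
  Matrix.of fun i j => if i < j then A i j else if j < i then -A j i else 0

/-- The Pfaffian of an upper-triangular array `(a_{ij})_{i < j}`. -/
def pfaffianUpper {n : ℕ} (A : Fin (2 * n) → Fin (2 * n) → ℝ) : ℝ :=
  pfaffian (skewOfUpper A)

/-- The covariance function of the Gaussian power series. -/
def covKernel (s t : ℝ) : ℝ := 1 / (1 - s * t)

/-- The correlation function `c(s,t)` of the Gaussian power series. -/
def corr (s t : ℝ) : ℝ := covKernel s t / √(covKernel s s * covKernel t t)

/-- The kernel `𝕂₂₂(s,t) = sgn(t - s) arcsin c(s,t)`. -/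
def K22 (s t : ℝ) : ℝ := Real.sign (t - s) * Real.arcsin (corr s t)

/-- The random power series `f(t) = ∑ aₖ tᵏ`. -/
def powerSeries {Ω : Type*} (a : ℕ → Ω → ℝ) (ω : Ω) (t : ℝ) : ℝ := ∑' k : ℕ, a k ω * t ^ k

end GaussianPowerSeries

end

/-! The mechanism is a self-similarity of the kernel. Conditioned on `f t = z`, the field is
distributed as `z r(s) + b(s) f(s)`, where `r` is the regression coefficient and `b` is the Blaschke
factor vanishing at `t`. In particular, given `f t = 0`, the field is a copy of itself multiplied by
`b`, and `b(s)` has the sign of `s - t`. Fixing a zero at `t` therefore alters a product of signs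
only by a deterministic sign.

Let `A(t)` be the mean of `sgn f(t) ∏_{x ∈ S} sgn f(x)`. Moving `t` changes `A` only through zeros
of `f` at `t`, so `A'(t)` is an explicit constant times `E[f(t) ∏ sgn f(x)]`
(`hasDerivAt_signMean`). Gaussian integration by parts turns this mean into a sum over `y ∈ S`: the
derivative of `sgn f(y)` puts a zero at `y`, leaving the sign mean of `S.erase y` times `∏ sgn(x -
y)` (`integral_mul_prod_sign`). The coefficient of each term is the derivative of `(2/π) arcsin
c(t,y)` when `t` lies to the left of `S`. As `t → -1`, both `A` and the arcsines tend to zero, so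
the derivative identity integrates to `signMean_expansion`.

For increasing points, `∏ sgn(x - y)` is the alternating sign in the expansion of a Pfaffian along
its first row (`pfaffian_succ`), and induction gives the formula. Distinct points in arbitrary order
are sorted; the Pfaffian and the product of `sgn(t_j - t_i)` then contribute the same permutation
sign (`pfaffian_submatrix_perm`, `prod_prod_sign_eq_sign_perm`). -/

noncomputable section

namespace GaussianPowerSeries

/-! ### The covariance kernel, regression coefficients and Blaschke factors -/

/-- The regression coefficient of `f s` on `f t`. -/
def regression (t s : ℝ) : ℝ := (1 - t ^ 2) / (1 - s * t)

/-- The Blaschke factor of the unit disc vanishing at `t`. -/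
def blaschke (t s : ℝ) : ℝ := (s - t) / (1 - s * t)

lemma one_sub_mul_pos {s t : ℝ} (hs : s ∈ Set.Ioo (-1 : ℝ) 1) (ht : t ∈ Set.Ioo (-1 : ℝ) 1) :
    0 < 1 - s * t := by
  obtain ⟨h1, h2⟩ := hs
  obtain ⟨h3, h4⟩ := ht
  nlinarith

lemma one_sub_sq_pos {t : ℝ} (ht : t ∈ Set.Ioo (-1 : ℝ) 1) : 0 < 1 - t ^ 2 := by
  rw [sq]; exact one_sub_mul_pos ht ht

lemma covKernel_comm (s t : ℝ) : covKernel s t = covKernel t s := by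
  unfold covKernel; rw [mul_comm]

lemma covKernel_pos {s t : ℝ} (hs : s ∈ Set.Ioo (-1 : ℝ) 1) (ht : t ∈ Set.Ioo (-1 : ℝ) 1) :
    0 < covKernel s t := one_div_pos.2 (one_sub_mul_pos hs ht)

lemma regression_pos {s t : ℝ} (hs : s ∈ Set.Ioo (-1 : ℝ) 1) (ht : t ∈ Set.Ioo (-1 : ℝ) 1) :
    0 < regression t s := div_pos (one_sub_sq_pos ht) (one_sub_mul_pos hs ht)

lemma regression_self {t : ℝ} (ht : t ∈ Set.Ioo (-1 : ℝ) 1) : regression t t = 1 := by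
  have := one_sub_sq_pos ht
  unfold regression
  rw [← sq, div_self this.ne']

lemma blaschke_self (t : ℝ) : blaschke t t = 0 := by simp [blaschke]

lemma blaschke_ne_zero {s t : ℝ} (hs : s ∈ Set.Ioo (-1 : ℝ) 1) (ht : t ∈ Set.Ioo (-1 : ℝ) 1)
    (h : s ≠ t) : blaschke t s ≠ 0 :=
  div_ne_zero (sub_ne_zero.2 h) (one_sub_mul_pos hs ht).ne'

lemma sign_mul_real (a b : ℝ) : Real.sign (a * b) = Real.sign a * Real.sign b := by
  rcases lt_trichotomy a 0 with ha | rfl | ha <;> rcases lt_trichotomy b 0 with hb | rfl | hb <;>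
    simp [Real.sign_of_pos, Real.sign_of_neg, mul_neg_of_neg_of_pos,
      mul_neg_of_pos_of_neg, mul_pos_of_neg_of_neg, *]

lemma sign_pos_mul {a : ℝ} (ha : 0 < a) (b : ℝ) : Real.sign (a * b) = Real.sign b := by
  rw [sign_mul_real, Real.sign_of_pos ha, one_mul]

lemma sign_blaschke {s t : ℝ} (hs : s ∈ Set.Ioo (-1 : ℝ) 1) (ht : t ∈ Set.Ioo (-1 : ℝ) 1) :
    Real.sign (blaschke t s) = Real.sign (s - t) := by
  rw [blaschke, div_eq_inv_mul, sign_pos_mul (inv_pos.2 (one_sub_mul_pos hs ht))]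

/-- The first summand is the part of the covariance explained by `f t`. That the residual covariance
is again the kernel, multiplied by Blaschke factors, is special to the Szegő kernel and drives the
whole proof. -/
lemma covKernel_decomposition {t s s' : ℝ} (ht : t ∈ Set.Ioo (-1 : ℝ) 1)
    (hs : s ∈ Set.Ioo (-1 : ℝ) 1) (hs' : s' ∈ Set.Ioo (-1 : ℝ) 1) :
    covKernel s s' = covKernel t t * (regression t s * regression t s') +
      blaschke t s * blaschke t s' * covKernel s s' := by
  have h1 := one_sub_mul_pos ht ht
  have h1' := one_sub_sq_pos ht
  have h2 := one_sub_mul_pos hs ht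
  have h3 := one_sub_mul_pos hs' ht
  have h4 := one_sub_mul_pos hs hs'
  unfold covKernel regression blaschke
  field_simp
  ring

/-! ### Szegő fields and conditioning on one value -/

/-- A random field with continuous paths on `(-1, 1)` and the finite-dimensional distributions
of the centred Gaussian field with covariance `covKernel`. -/
structure IsSzegoField {Ω : Type*} [MeasurableSpace Ω] (P : Measure Ω) (f : ℝ → Ω → ℝ) :
    Prop where
  measurable : ∀ t ∈ Set.Ioo (-1 : ℝ) 1, Measurable (f t)
  continuousAt : ∀ ω, ∀ t ∈ Set.Ioo (-1 : ℝ) 1, ContinuousAt (fun s => f s ω) t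
  -- The locally uniform integrable bound supplies the domination when a point of the field is
  -- moved.
  exists_majorant : ∀ r ∈ Set.Ioo (0 : ℝ) 1, ∃ M : Ω → ℝ, Measurable M ∧ Integrable M P ∧
    ∀ ω s, |s| ≤ r → |f s ω| ≤ M ω
  charFun_eq : ∀ (ι : Type) [Fintype ι] (s ξ : ι → ℝ), (∀ i, s i ∈ Set.Ioo (-1 : ℝ) 1) →
    ∫ ω, Complex.exp ((∑ i, ξ i * f (s i) ω : ℝ) * Complex.I) ∂P =
      Complex.exp (-((∑ i, ∑ j, ξ i * ξ j * covKernel (s i) (s j) : ℝ)) / 2)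

lemma measurable_sign : Measurable Real.sign := by
  unfold Real.sign
  exact Measurable.ite measurableSet_Iio measurable_const
    (Measurable.ite measurableSet_Ioi measurable_const measurable_const)

lemma abs_sign_le (x : ℝ) : |Real.sign x| ≤ 1 := by
  rcases Real.sign_apply_eq x with h | h | h <;> simp [h]

lemma abs_prod_sign_le {ι : Type*} (S : Finset ι) (g : ι → ℝ) :
    |∏ x ∈ S, Real.sign (g x)| ≤ 1 := by
  rw [Finset.abs_prod]
  exact Finset.prod_le_one (fun _ _ => abs_nonneg _) (fun _ _ => abs_sign_le _)

/-- The variance of `f t` as a nonnegative real. -/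
def varAt (t : ℝ) : NNReal := (covKernel t t).toNNReal

lemma coe_varAt {t : ℝ} (ht : t ∈ Set.Ioo (-1 : ℝ) 1) : (varAt t : ℝ) = covKernel t t :=
  Real.coe_toNNReal _ (covKernel_pos ht ht).le

lemma varAt_ne_zero {t : ℝ} (ht : t ∈ Set.Ioo (-1 : ℝ) 1) : varAt t ≠ 0 := by
  rw [← NNReal.coe_ne_zero, coe_varAt ht]
  exact (covKernel_pos ht ht).ne'

namespace IsSzegoField

variable {Ω : Type*} [MeasurableSpace Ω] {P : Measure Ω} [IsProbabilityMeasure P] {f : ℝ → Ω → ℝ}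

/-- Both sides are centred Gaussian vectors, and `covKernel_decomposition` says that their
covariances agree, so their characteristic functions coincide. The second component of the product
space plays the value of `f t`. -/
lemma map_eq_map_decomposition (hf : IsSzegoField P f) {t : ℝ} (ht : t ∈ Set.Ioo (-1 : ℝ) 1)
    {ι : Type} [Fintype ι] (s : ι → ℝ) (hs : ∀ i, s i ∈ Set.Ioo (-1 : ℝ) 1) :
    P.map (fun ω i => f (s i) ω) = (P.prod (gaussianReal 0 (varAt t))).map
      (fun p i => p.2 * regression t (s i) + blaschke t (s i) * f (s i) p.1) := by
  have hm1 : Measurable (fun ω i => f (s i) ω) :=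
    measurable_pi_lambda _ fun i => hf.measurable _ (hs i)
  have hm2 : Measurable (fun (p : Ω × ℝ) i =>
      p.2 * regression t (s i) + blaschke t (s i) * f (s i) p.1) := by
    refine measurable_pi_lambda _ fun i => ?_
    have := (hf.measurable _ (hs i)).comp (measurable_fst : Measurable (Prod.fst : Ω × ℝ → Ω))
    exact (measurable_snd.mul_const _).add (this.const_mul _)
  have key : (P.map (fun ω i => f (s i) ω)).map (WithLp.toLp 2) =
      ((P.prod (gaussianReal 0 (varAt t))).map
      (fun p i => p.2 * regression t (s i) + blaschke t (s i) * f (s i) p.1)).map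
        (WithLp.toLp 2) := by
    have i1 := Measure.isProbabilityMeasure_map (μ := P) hm1.aemeasurable
    have i2 := Measure.isProbabilityMeasure_map (μ := P.prod (gaussianReal 0 (varAt t)))
      hm2.aemeasurable
    have hL : Measurable (WithLp.toLp 2 : (ι → ℝ) → EuclideanSpace ℝ ι) :=
      WithLp.measurable_toLp 2 _
    have i3 := Measure.isProbabilityMeasure_map (μ := P.map (fun ω i => f (s i) ω))
      hL.aemeasurable
    have i4 := Measure.isProbabilityMeasure_map (μ := (P.prod (gaussianReal 0 (varAt t))).map
      (fun p i => p.2 * regression t (s i) + blaschke t (s i) * f (s i) p.1))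
      hL.aemeasurable
    refine Measure.ext_of_charFun (funext fun ξ => ?_)
    rw [charFun_apply, charFun_apply, integral_map hL.aemeasurable (by fun_prop),
      integral_map hL.aemeasurable (by fun_prop), integral_map hm1.aemeasurable (by fun_prop),
      integral_map hm2.aemeasurable (by fun_prop)]
    simp only [PiLp.inner_apply, RCLike.inner_apply, conj_trivial]
    rw [hf.charFun_eq ι s (fun i => ξ i) hs]
    have e : ∀ p : Ω × ℝ,
        Complex.exp (((∑ i, ξ i * (p.2 * regression t (s i) +
          blaschke t (s i) * f (s i) p.1) : ℝ)) * Complex.I) =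
        Complex.exp (((∑ i, (ξ i * blaschke t (s i)) * f (s i) p.1 : ℝ)) * Complex.I) *
          Complex.exp (((∑ i, ξ i * regression t (s i) : ℝ)) * p.2 * Complex.I) := by
      intro p
      rw [← Complex.exp_add, ← add_mul, ← Complex.ofReal_mul, ← Complex.ofReal_add,
        Finset.sum_mul, ← Finset.sum_add_distrib]
      congr 3
      exact Finset.sum_congr rfl fun i _ => by ring
    simp_rw [e]
    rw [integral_prod_mul (fun ω => Complex.exp
      (((∑ i, (ξ i * blaschke t (s i)) * f (s i) ω : ℝ)) * Complex.I))
      (fun z : ℝ => Complex.exp (((∑ i, ξ i * regression t (s i) : ℝ)) * z * Complex.I)),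
      hf.charFun_eq ι s _ hs, ← charFun_apply_real, charFun_gaussianReal, ← Complex.exp_add]
    congr 1
    rw [show ((varAt t : NNReal) : ℂ) = ((covKernel t t : ℝ) : ℂ) by
      rw [← coe_varAt ht]]
    have h : ∑ i, ∑ j, ξ i * ξ j * covKernel (s i) (s j) =
        ∑ i, ∑ j, ξ i * blaschke t (s i) * (ξ j * blaschke t (s j)) * covKernel (s i) (s j) +
          covKernel t t * (∑ i, ξ i * regression t (s i)) ^ 2 := by
      rw [sq, Finset.sum_mul_sum, Finset.mul_sum, ← Finset.sum_add_distrib]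
      refine Finset.sum_congr rfl fun i _ => ?_
      rw [Finset.mul_sum, ← Finset.sum_add_distrib]
      refine Finset.sum_congr rfl fun j _ => ?_
      linear_combination (ξ i * ξ j) * covKernel_decomposition ht (hs i) (hs j)
    rw [h]
    push_cast
    ring
  have := congrArg (Measure.map (WithLp.ofLp)) key
  have hL : Measurable (WithLp.toLp 2 : (ι → ℝ) → EuclideanSpace ℝ ι) :=
    WithLp.measurable_toLp 2 _
  have hL' : Measurable (WithLp.ofLp : EuclideanSpace ℝ ι → (ι → ℝ)) :=
    WithLp.measurable_ofLp 2 _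
  rw [Measure.map_map hL' hL, Measure.map_map hL' hL] at this
  simpa [Function.comp_def] using this

/-- Integration with respect to `f` after conditioning on the value of `f t`. -/
lemma integral_eq_integral_prod (hf : IsSzegoField P f) {t : ℝ} (ht : t ∈ Set.Ioo (-1 : ℝ) 1)
    (T : Finset ℝ) (hT : ∀ x ∈ T, x ∈ Set.Ioo (-1 : ℝ) 1) (G : (ℝ → ℝ) → ℝ) (hG : Measurable G)
    (hGT : ∀ v w : ℝ → ℝ, (∀ x ∈ T, v x = w x) → G v = G w) :
    ∫ ω, G (fun s => f s ω) ∂P = ∫ p, G (fun s => p.2 * regression t s + blaschke t s * f s p.1)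
      ∂(P.prod (gaussianReal 0 (varAt t))) := by
  classical
  -- Extension by zero: since `G` reads only coordinates in `T`, it factors through this map, and
  -- the finite-dimensional identity of laws applies.
  let E : (T → ℝ) → (ℝ → ℝ) := fun u x => if h : x ∈ T then u ⟨x, h⟩ else 0
  have hE : Measurable E := by
    refine measurable_pi_lambda _ fun x => ?_
    by_cases h : x ∈ T
    · simp only [E, h, dif_pos]; exact measurable_pi_apply _
    · simp only [E, h, dif_neg, not_false_eq_true]; exact measurable_const
  have hs : ∀ i : T, (i : ℝ) ∈ Set.Ioo (-1 : ℝ) 1 := fun i => hT _ i.2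
  have hm1 : Measurable (fun ω (i : T) => f i ω) :=
    measurable_pi_lambda _ fun i => hf.measurable _ (hs i)
  have hm2 : Measurable (fun (p : Ω × ℝ) (i : T) =>
      p.2 * regression t i + blaschke t i * f i p.1) := by
    refine measurable_pi_lambda _ fun i => ?_
    have := (hf.measurable _ (hs i)).comp (measurable_fst : Measurable (Prod.fst : Ω × ℝ → Ω))
    exact (measurable_snd.mul_const _).add (this.const_mul _)
  have hGE : ∀ v : ℝ → ℝ, G v = (G ∘ E) (fun i : T => v i) := fun v =>
    hGT _ _ fun x hx => by simp [E, hx]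
  have hm : Measurable (G ∘ E) := hG.comp hE
  have := hf.map_eq_map_decomposition ht (fun i : T => (i : ℝ)) hs
  have h1 := integral_map (μ := P) hm1.aemeasurable (f := G ∘ E) hm.aestronglyMeasurable
  have h2 := integral_map (μ := P.prod (gaussianReal 0 (varAt t))) hm2.aemeasurable (f := G ∘ E)
    hm.aestronglyMeasurable
  rw [this, h2] at h1
  calc _ = ∫ ω, (G ∘ E) (fun i : T => f i ω) ∂P := integral_congr_ae (ae_of_all _ fun ω => hGE _)
    _ = _ := h1.symm
    _ = _ := integral_congr_ae (ae_of_all _ fun p =>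
        (hGE (fun s => p.2 * regression t s + blaschke t s * f s p.1)).symm)

end IsSzegoField

/-! ### Localisation at a sign change of a Gaussian variable -/

section

open Filter Topology

/-- A shift by at most `m` cannot change the sign of a number of modulus above `m`. This is the
bound that makes the rescaled integrand integrable over the whole line. -/
lemma abs_sign_add_sub_sign_le {z u m : ℝ} (h : |u| ≤ m) :
    |Real.sign (z + u) - Real.sign z| ≤ Set.indicator (Set.Icc (-m) m) (fun _ => 2) z := by
  by_cases hz : z ∈ Set.Icc (-m) m
  · rw [Set.indicator_of_mem hz]
    calc _ ≤ |Real.sign (z + u)| + |Real.sign z| := abs_sub _ _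
      _ ≤ 2 := by linarith [abs_sign_le (z + u), abs_sign_le z]
  · rw [Set.indicator_of_notMem hz]
    rw [abs_le] at h
    rw [Set.mem_Icc, not_and_or, not_le, not_le] at hz
    rcases hz with hz | hz
    · rw [Real.sign_of_neg (by linarith : z < 0), Real.sign_of_neg (by linarith)]; simp
    · rw [Real.sign_of_pos (by linarith : 0 < z), Real.sign_of_pos (by linarith)]; simp

lemma integral_sign_add_sub_sign (u : ℝ) :
    ∫ z, (Real.sign (z + u) - Real.sign z) = 2 * u := by
  rcases le_total 0 u with hu | hu
  · have : (fun z => Real.sign (z + u) - Real.sign z) =ᵐ[volume]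
        Set.indicator (Set.Ioc (-u) 0) (fun _ => (2 : ℝ)) := by
      filter_upwards [Measure.ae_ne volume (-u), Measure.ae_ne volume (0 : ℝ)] with z h1 h2
      by_cases hz : z ∈ Set.Ioc (-u) 0
      · rw [Set.indicator_of_mem hz, Real.sign_of_pos (by linarith [hz.1]),
          Real.sign_of_neg (lt_of_le_of_ne hz.2 h2)]
        norm_num
      · rw [Set.indicator_of_notMem hz]
        rw [Set.mem_Ioc, not_and_or, not_lt, not_le] at hz
        rcases hz with hz | hz
        · have := lt_of_le_of_ne hz h1
          rw [Real.sign_of_neg (by linarith : z < 0), Real.sign_of_neg (by linarith)]; simp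
        · rw [Real.sign_of_pos (by linarith : 0 < z), Real.sign_of_pos (by linarith)]; simp
    rw [integral_congr_ae this, integral_indicator measurableSet_Ioc]
    simp [hu, mul_comm]
  · have : (fun z => Real.sign (z + u) - Real.sign z) =ᵐ[volume]
        Set.indicator (Set.Ioc 0 (-u)) (fun _ => (-2 : ℝ)) := by
      filter_upwards [Measure.ae_ne volume (-u), Measure.ae_ne volume (0 : ℝ)] with z h1 h2
      by_cases hz : z ∈ Set.Ioc 0 (-u)
      · have := lt_of_le_of_ne hz.2 h1
        rw [Set.indicator_of_mem hz, Real.sign_of_neg (by linarith),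
          Real.sign_of_pos hz.1]
        norm_num
      · rw [Set.indicator_of_notMem hz]
        rw [Set.mem_Ioc, not_and_or, not_lt, not_le] at hz
        rcases hz with hz | hz
        · have := lt_of_le_of_ne hz h2
          rw [Real.sign_of_neg (by linarith : z < 0), Real.sign_of_neg (by linarith)]; simp
        · rw [Real.sign_of_pos (by linarith : 0 < z), Real.sign_of_pos (by linarith)]; simp
    rw [integral_congr_ae this, integral_indicator measurableSet_Ioc]
    simp [hu, mul_comm]

lemma tendsto_sign {α : Type*} {l : Filter α} {g : α → ℝ} {c : ℝ} (hc : c ≠ 0)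
    (hg : Tendsto g l (𝓝 c)) : Tendsto (fun a => Real.sign (g a)) l (𝓝 (Real.sign c)) := by
  refine tendsto_const_nhds.congr' ?_
  rcases lt_or_gt_of_ne hc with h | h
  · filter_upwards [hg.eventually (gt_mem_nhds h)] with a ha
    rw [Real.sign_of_neg h, Real.sign_of_neg ha]
  · filter_upwards [hg.eventually (lt_mem_nhds h)] with a ha
    rw [Real.sign_of_pos h, Real.sign_of_pos ha]

lemma integrable_indicator_Icc_prod {Ω : Type*} [MeasurableSpace Ω] {P : Measure Ω}
    [IsProbabilityMeasure P] {M : Ω → ℝ} (hM : Measurable M) (hMi : Integrable M P) :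
    Integrable (fun p : Ω × ℝ => Set.indicator (Set.Icc (-M p.1) (M p.1)) (fun _ => (2 : ℝ)) p.2)
      (P.prod volume) := by
  have hset : MeasurableSet {p : Ω × ℝ | p.2 ∈ Set.Icc (-M p.1) (M p.1)} := by
    refine (measurableSet_le (f := fun p : Ω × ℝ => -M p.1) (g := fun p => p.2)
      (by fun_prop) (by fun_prop)).inter
      (measurableSet_le (f := fun p : Ω × ℝ => p.2) (g := fun p => M p.1) (by fun_prop)
        (by fun_prop))
  have hm : Measurable (fun p : Ω × ℝ =>
      Set.indicator (Set.Icc (-M p.1) (M p.1)) (fun _ => (2 : ℝ)) p.2) :=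
    Measurable.indicator (s := {p : Ω × ℝ | p.2 ∈ Set.Icc (-M p.1) (M p.1)})
      (measurable_const (a := (2 : ℝ))) hset
  rw [integrable_prod_iff hm.aestronglyMeasurable]
  refine ⟨ae_of_all _ fun ω => ?_, ?_⟩
  · have : IntegrableOn (fun _ : ℝ => (2 : ℝ)) (Set.Icc (-M ω) (M ω)) :=
      continuousOn_const.integrableOn_Icc
    exact this.integrable_indicator measurableSet_Icc
  · have e : ∀ ω, ∫ z, ‖Set.indicator (Set.Icc (-M ω) (M ω)) (fun _ => (2 : ℝ)) z‖ =
        2 * max (M ω + M ω) 0 := by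
      intro ω
      simp_rw [norm_indicator_eq_indicator_norm]
      rw [integral_indicator measurableSet_Icc]
      simp [measureReal_def, ENNReal.toReal_ofReal', mul_comm]
    simp only [e]
    exact ((hMi.add hMi).pos_part).const_mul 2

/-- The derivative of the expectation of a product at a sign change of a Gaussian variable `z`,
localised at `z = 0`. -/
lemma tendsto_integral_sign_crossing {Ω : Type*} [MeasurableSpace Ω] {P : Measure Ω}
    [IsProbabilityMeasure P] {v : NNReal} (hv : v ≠ 0) {U : ℝ → Ω → ℝ} {G : ℝ → Ω → ℝ → ℝ}
    {U₀ G₀ M : Ω → ℝ} (hM : Measurable M) (hMi : Integrable M P)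
    (hU : ∀ᶠ ε in 𝓝[≠] 0, Measurable (U ε))
    (hUM : ∀ᶠ ε in 𝓝[≠] 0, ∀ ω, |U ε ω| ≤ M ω)
    (hUlim : ∀ ω, Tendsto (fun ε => U ε ω) (𝓝[≠] 0) (𝓝 (U₀ ω)))
    (hG : ∀ᶠ ε in 𝓝[≠] 0, Measurable (Function.uncurry (G ε)))
    (hG1 : ∀ᶠ ε in 𝓝[≠] 0, ∀ ω z, |G ε ω z| ≤ 1)
    (hGlim : ∀ᵐ ω ∂P, ∀ z, Tendsto (fun ε => G ε ω (ε * z)) (𝓝[≠] 0) (𝓝 (G₀ ω))) :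
    Tendsto (fun ε => ε⁻¹ * ∫ p, (Real.sign (p.2 + ε * U ε p.1) - Real.sign p.2) * G ε p.1 p.2
      ∂(P.prod (gaussianReal 0 v))) (𝓝[≠] 0)
      (𝓝 (2 * gaussianPDFReal 0 v 0 * ∫ ω, U₀ ω * G₀ ω ∂P)) := by
  set ρ := gaussianPDFReal 0 v with hρ
  have hρm : Measurable ρ := measurable_gaussianPDFReal 0 v
  have hρ0 : ∀ z, 0 ≤ ρ z := gaussianPDFReal_nonneg 0 v
  have hρle : ∀ z, ρ z ≤ ρ 0 := by
    intro z
    simp only [hρ, gaussianPDFReal]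
    refine mul_le_mul_of_nonneg_left (Real.exp_le_exp.2 ?_) (by positivity)
    simp only [sub_zero, ne_eq, OfNat.ofNat_ne_zero, not_false_eq_true, zero_pow, neg_zero,
      zero_div]
    exact div_nonpos_of_nonpos_of_nonneg (by nlinarith) (by positivity)
  have hρc : Continuous ρ := by
    simp only [hρ, gaussianPDFReal_def]
    fun_prop
  -- The integrand after the substitution `z ↦ ε z`, which blows up the window of width of order `ε`
  -- in which the sign changes; the prefactor `ε⁻¹` is absorbed by the Jacobian.
  let N : ℝ → Ω × ℝ → ℝ := fun ε p =>
    ρ (ε * p.2) * ((Real.sign (p.2 + U ε p.1) - Real.sign p.2) * G ε p.1 (ε * p.2))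
  let N₀ : Ω × ℝ → ℝ := fun p =>
    ρ 0 * ((Real.sign (p.2 + U₀ p.1) - Real.sign p.2) * G₀ p.1)
  -- For fixed `ω` this has integral `4 ρ(0) M(ω)`, so integrability of `M` suffices.
  let B : Ω × ℝ → ℝ := fun p =>
    ρ 0 * Set.indicator (Set.Icc (-M p.1) (M p.1)) (fun _ => (2 : ℝ)) p.2
  have hB : Integrable B (P.prod volume) := (integrable_indicator_Icc_prod hM hMi).const_mul _
  have hNm : ∀ᶠ ε in 𝓝[≠] 0, Measurable (N ε) := by
    filter_upwards [hU, hG] with ε h1 h2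
    have h3 : Measurable (fun p : Ω × ℝ => G ε p.1 (ε * p.2)) :=
      h2.comp (measurable_fst.prodMk (measurable_snd.const_mul ε))
    exact (hρm.comp (measurable_snd.const_mul ε)).mul
      (((measurable_sign.comp (measurable_snd.add (h1.comp measurable_fst))).sub
        (measurable_sign.comp measurable_snd)).mul h3)
  have hNB : ∀ᶠ ε in 𝓝[≠] 0, ∀ p, ‖N ε p‖ ≤ B p := by
    filter_upwards [hUM, hG1] with ε h1 h2 p
    rw [Real.norm_eq_abs, abs_mul, abs_mul, abs_of_nonneg (hρ0 _)]
    refine mul_le_mul (hρle _) ?_ (by positivity) (hρ0 _)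
    calc _ ≤ |Real.sign (p.2 + U ε p.1) - Real.sign p.2| * 1 :=
          mul_le_mul_of_nonneg_left (h2 _ _) (abs_nonneg _)
      _ ≤ _ := by rw [mul_one]; exact abs_sign_add_sub_sign_le (h1 _)
  have hU₀m : Measurable U₀ := by
    obtain ⟨u, hu⟩ := exists_seq_tendsto (𝓝[≠] (0 : ℝ))
    obtain ⟨n, hn⟩ := eventually_atTop.1 (hu.eventually hU)
    refine measurable_of_tendsto_metrizable (f := fun k => U (u (k + n)))
      (fun k => hn _ (Nat.le_add_left _ _)) (tendsto_pi_nhds.2 fun ω => ?_)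
    exact (hUlim ω).comp (hu.comp (tendsto_add_atTop_nat n))
  -- The sign is discontinuous only at zero, which for each `ω` excludes a single `z`.
  have hne : ∀ᵐ p ∂(P.prod (volume : Measure ℝ)), p.2 + U₀ p.1 ≠ 0 := by
    refine (Measure.ae_prod_iff_ae_ae ?_).2 (ae_of_all _ fun ω => ?_)
    · exact (measurableSet_eq_fun (measurable_snd.add (hU₀m.comp measurable_fst))
        measurable_const).compl
    · filter_upwards [Measure.ae_ne volume (-U₀ ω)] with z hz h
      exact hz (by linarith)
  have hNlim : ∀ᵐ p ∂(P.prod (volume : Measure ℝ)),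
      Tendsto (fun ε => N ε p) (𝓝[≠] 0) (𝓝 (N₀ p)) := by
    have hG' : ∀ᵐ p ∂(P.prod (volume : Measure ℝ)),
        ∀ z, Tendsto (fun ε => G ε p.1 (ε * z)) (𝓝[≠] 0) (𝓝 (G₀ p.1)) :=
      Measure.quasiMeasurePreserving_fst.ae hGlim
    filter_upwards [hne, hG'] with p h1 h2
    refine Tendsto.mul ?_ (((tendsto_sign h1 ?_).sub tendsto_const_nhds).mul (h2 _))
    · have : Tendsto (fun ε : ℝ => ρ (ε * p.2)) (𝓝 0) (𝓝 (ρ (0 * p.2))) :=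
        (hρc.comp (continuous_id.mul continuous_const)).tendsto 0
      rw [zero_mul] at this
      exact this.mono_left nhdsWithin_le_nhds
    · exact tendsto_const_nhds.add (hUlim _)
  have hN₀i : Integrable N₀ (P.prod volume) := by
    refine hB.mono' ?_ ?_
    · obtain ⟨u, hu⟩ := exists_seq_tendsto (𝓝[≠] (0 : ℝ))
      obtain ⟨n, hn⟩ := eventually_atTop.1 (hu.eventually hNm)
      refine aestronglyMeasurable_of_tendsto_ae atTop (f := fun k => N (u (k + n)))
        (fun k => (hn _ (Nat.le_add_left _ _)).aestronglyMeasurable) ?_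
      filter_upwards [hNlim] with p hp
      exact hp.comp (hu.comp (tendsto_add_atTop_nat n))
    · filter_upwards [hNlim] with p hp
      exact le_of_tendsto hp.norm (hNB.mono fun ε h => h p)
  have hlim : Tendsto (fun ε => ∫ p, N ε p ∂(P.prod volume)) (𝓝[≠] 0)
      (𝓝 (∫ p, N₀ p ∂(P.prod volume))) :=
    tendsto_integral_filter_of_dominated_convergence B
      (hNm.mono fun ε h => h.aestronglyMeasurable) (hNB.mono fun ε h => ae_of_all _ h) hB hNlim
  have hN₀ : ∫ p, N₀ p ∂(P.prod volume) = 2 * ρ 0 * ∫ ω, U₀ ω * G₀ ω ∂P := by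
    rw [integral_prod _ hN₀i, ← integral_const_mul]
    refine integral_congr_ae (ae_of_all _ fun ω => ?_)
    simp only [N₀]
    rw [integral_const_mul, integral_mul_const, integral_sign_add_sub_sign]
    ring
  rw [hN₀] at hlim
  refine hlim.congr' ?_
  filter_upwards [hU, hG, hG1, hNm, hNB, self_mem_nhdsWithin] with ε h1 h2 h3 h4 h5 h6
  have hε : ε ≠ 0 := h6
  have hNi : Integrable (N ε) (P.prod volume) := hB.mono' h4.aestronglyMeasurable (ae_of_all _ h5)
  have hI : Integrable (fun p : Ω × ℝ =>
      (Real.sign (p.2 + ε * U ε p.1) - Real.sign p.2) * G ε p.1 p.2)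
      (P.prod (gaussianReal 0 v)) := by
    refine Integrable.of_bound (C := 2) (Measurable.aestronglyMeasurable ?_)
      (ae_of_all _ fun p => ?_)
    · exact ((measurable_sign.comp (measurable_snd.add
        ((h1.comp measurable_fst).const_mul ε))).sub (measurable_sign.comp measurable_snd)).mul h2
    · rw [Real.norm_eq_abs, abs_mul]
      calc |Real.sign (p.2 + ε * U ε p.1) - Real.sign p.2| * |G ε p.1 p.2| ≤ 2 * 1 := by
            refine mul_le_mul ?_ (h3 _ _) (abs_nonneg _) zero_le_two
            calc _ ≤ |Real.sign (p.2 + ε * U ε p.1)| + |Real.sign p.2| := abs_sub _ _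
              _ ≤ 2 := by linarith [abs_sign_le (p.2 + ε * U ε p.1), abs_sign_le p.2]
        _ = 2 := mul_one 2
  rw [integral_prod _ hI, integral_prod _ hNi, ← integral_const_mul]
  refine integral_congr_ae (ae_of_all _ fun ω => ?_)
  simp only
  rw [integral_gaussianReal_eq_integral_smul hv]
  -- The Jacobian gives `|ε|⁻¹`; pulling `ε` out of both signs gives a factor `sgn ε`, and together
  -- they yield `ε⁻¹` for either sign of `ε`.
  have hsub := Measure.integral_comp_mul_left (fun z => ρ z •
    ((Real.sign (z + ε * U ε ω) - Real.sign z) * G ε ω z)) ε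
  have hs : ∀ z, ρ (ε * z) • ((Real.sign (ε * z + ε * U ε ω) - Real.sign (ε * z)) *
      G ε ω (ε * z)) = Real.sign ε * N ε (ω, z) := by
    intro z
    rw [← mul_add, sign_mul_real, sign_mul_real]
    simp only [N, smul_eq_mul]
    ring
  simp only [hs] at hsub
  rw [integral_const_mul, smul_eq_mul, abs_inv] at hsub
  have habs : |ε| = Real.sign ε * ε := by
    rcases lt_or_gt_of_ne hε with h | h
    · rw [abs_of_neg h, Real.sign_of_neg h]; ring
    · rw [abs_of_pos h, Real.sign_of_pos h]; ring
  have hsε : Real.sign ε ≠ 0 := by simpa [Real.sign_eq_zero_iff] using hε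
  rw [habs, mul_inv, Real.inv_sign, mul_assoc] at hsub
  exact mul_left_cancel₀ hsε hsub

end

/-! ### Differentiating a sign mean with respect to one point -/

section

open Filter Topology

/-- The expectation of the product of the signs of `f` over a finite set of points. -/
def signMean {Ω : Type*} [MeasurableSpace Ω] (P : Measure Ω) (f : ℝ → Ω → ℝ) (S : Finset ℝ) : ℝ :=
  ∫ ω, ∏ x ∈ S, Real.sign (f x ω) ∂P

/-- Gaussian integration by parts, for translations of a bounded function. -/
lemma hasDerivAt_integral_gaussianReal_add {v : NNReal} (hv : v ≠ 0) {h : ℝ → ℝ}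
    (hm : Measurable h) (h1 : ∀ z, |h z| ≤ 1) :
    HasDerivAt (fun ε => ∫ z, h (z + ε) ∂(gaussianReal 0 v))
      ((v : ℝ)⁻¹ * ∫ z, z * h z ∂(gaussianReal 0 v)) 0 := by
  set ρ := gaussianPDFReal 0 v with hρ
  have hv0 : (0 : ℝ) < v := by positivity
  have hρm : Measurable ρ := measurable_gaussianPDFReal 0 v
  set c : ℝ := (√(2 * Real.pi * v))⁻¹ with hc
  have hc0 : 0 ≤ c := by positivity
  have hρe : ∀ z, ρ z = c * Real.exp (-z ^ 2 / (2 * v)) := fun z => by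
    simp [hρ, gaussianPDFReal, hc]
  -- Translation invariance moves the shift from the merely measurable `h` to the smooth density.
  have e1 : ∀ ε, ∫ z, h (z + ε) ∂(gaussianReal 0 v) = ∫ z, ρ (z - ε) * h z := by
    intro ε
    rw [integral_gaussianReal_eq_integral_smul hv]
    have := integral_add_right_eq_self (μ := volume) (fun z => ρ (z - ε) * h z) ε
    simpa using this
  have e2 : ((v : ℝ)⁻¹ * ∫ z, z * h z ∂(gaussianReal 0 v)) =
      ∫ z, ((z - 0) / v * ρ (z - 0)) * h z := by
    rw [integral_gaussianReal_eq_integral_smul hv, ← integral_const_mul]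
    refine integral_congr_ae (ae_of_all _ fun z => ?_)
    simp only [sub_zero, smul_eq_mul]
    ring
  simp only [e1]
  rw [e2]
  -- For `|ε| ≤ 1` one has `(z - ε)² ≥ z²/2 - 1`, and `|z - ε| ≤ |z| + 1`; halving the exponent buys
  -- uniformity in `ε`.
  let B : ℝ → ℝ := fun z => (c * Real.exp (1 / (2 * v)) / v) *
    (|z * Real.exp (-(1 / (4 * v)) * z ^ 2)| + Real.exp (-(1 / (4 * v)) * z ^ 2))
  have hb : (0 : ℝ) < 1 / (4 * v) := by positivity
  have hB : Integrable B :=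
    ((integrable_mul_exp_neg_mul_sq hb).abs.add (integrable_exp_neg_mul_sq hb)).const_mul _
  refine (hasDerivAt_integral_of_dominated_loc_of_deriv_le (F := fun ε z => ρ (z - ε) * h z)
    (F' := fun ε z => ((z - ε) / v * ρ (z - ε)) * h z) (bound := B)
    (s := Metric.ball 0 1) (Metric.ball_mem_nhds _ one_pos) ?_ ?_ ?_ ?_ hB ?_).2
  · exact Eventually.of_forall fun ε =>
      ((hρm.comp (measurable_id.sub_const ε)).mul hm).aestronglyMeasurable
  · simp only [sub_zero]
    refine (Integrable.bdd_mul (c := 1) (integrable_gaussianPDFReal 0 v) hm.aestronglyMeasurable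
      (ae_of_all _ h1)).congr (ae_of_all _ fun z => mul_comm _ _)
  · refine Measurable.aestronglyMeasurable ?_
    exact (((measurable_id.sub_const _).div_const _).mul
      (hρm.comp (measurable_id.sub_const _))).mul hm
  · refine ae_of_all _ fun z ε hε => ?_
    rw [mem_ball_zero_iff, Real.norm_eq_abs] at hε
    have hq : Real.exp (-(z - ε) ^ 2 / (2 * v)) ≤
        Real.exp (1 / (2 * v)) * Real.exp (-(1 / (4 * v)) * z ^ 2) := by
      rw [← Real.exp_add]
      refine Real.exp_le_exp.2 ?_
      have h2 : ε ^ 2 ≤ 1 := by rw [← sq_abs]; nlinarith [abs_nonneg ε]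
      have h3 : -(z - ε) ^ 2 ≤ 1 - z ^ 2 / 2 := by nlinarith [sq_nonneg (z - 2 * ε)]
      calc _ ≤ (1 - z ^ 2 / 2) / (2 * v) := by gcongr
        _ = _ := by field_simp; ring
    rw [Real.norm_eq_abs, abs_mul, abs_mul, abs_div, abs_of_pos hv0, hρe,
      abs_of_nonneg (mul_nonneg hc0 (Real.exp_pos _).le)]
    have ha : |z - ε| ≤ |z| + 1 := (abs_sub _ _).trans (by linarith)
    calc _ ≤ (|z| + 1) / v * (c * (Real.exp (1 / (2 * v)) * Real.exp (-(1 / (4 * v)) * z ^ 2)))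
          * 1 := by
          gcongr
          exact h1 z
      _ = B z := by
          simp only [B]
          rw [abs_mul, abs_of_pos (Real.exp_pos _)]
          ring
  · refine ae_of_all _ fun z ε _ => ?_
    refine HasDerivAt.mul_const ?_ _
    simp only [hρe]
    have h1 : HasDerivAt (fun x : ℝ => -(z - x) ^ 2 / (2 * v)) ((z - ε) / v) ε := by
      have := (((hasDerivAt_id ε).const_sub z).pow 2).neg.div_const (2 * (v : ℝ))
      refine this.congr_deriv ?_
      simp
      field_simp
    refine (h1.exp.const_mul c).congr_deriv ?_
    ring

namespace IsSzegoField

variable {Ω : Type*} [MeasurableSpace Ω] {P : Measure Ω} [IsProbabilityMeasure P] {f : ℝ → Ω → ℝ}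

/-- At `s = t` the regression coefficient is one and the Blaschke factor is zero, so the
decomposition identifies `f t` as a nondegenerate Gaussian variable, which has no atoms. -/
lemma ae_ne_zero (hf : IsSzegoField P f) {t : ℝ} (ht : t ∈ Set.Ioo (-1 : ℝ) 1) :
    ∀ᵐ ω ∂P, f t ω ≠ 0 := by
  have hm : Measurable (Set.indicator {(0 : ℝ)} (fun _ => (1 : ℝ))) :=
    measurable_const.indicator (measurableSet_singleton 0)
  have := hf.integral_eq_integral_prod ht {t} (by simpa using ht)
    (fun v => Set.indicator {(0 : ℝ)} (fun _ => (1 : ℝ)) (v t))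
    (hm.comp (measurable_pi_apply t)) (fun v w h => by rw [h t (by simp)])
  simp only [regression_self ht, blaschke_self, zero_mul, add_zero, mul_one] at this
  have h0 : ∫ p : Ω × ℝ, Set.indicator {(0 : ℝ)} (fun _ => (1 : ℝ)) p.2
      ∂(P.prod (gaussianReal 0 (varAt t))) = 0 := by
    have := nullSingletonClass_gaussianReal (μ := 0) (varAt_ne_zero ht)
    rw [integral_fun_snd (fun z => Set.indicator {(0 : ℝ)} (fun _ => (1 : ℝ)) z)]
    rw [integral_indicator (measurableSet_singleton 0)]
    simp
  rw [h0, integral_eq_zero_iff_of_nonneg (fun ω => Set.indicator_nonneg (by simp) _)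
    (Integrable.of_bound (C := 1) (hm.comp (hf.measurable t ht)).aestronglyMeasurable
      (ae_of_all _ fun ω => ?_))] at this
  · filter_upwards [this] with ω hω h
    simp [h] at hω
  · by_cases h : f t ω = 0 <;> simp [h]

omit [IsProbabilityMeasure P] in
lemma measurable_prod_sign (hf : IsSzegoField P f) {S : Finset ℝ}
    (hS : ∀ x ∈ S, x ∈ Set.Ioo (-1 : ℝ) 1) :
    Measurable fun ω => ∏ x ∈ S, Real.sign (f x ω) :=
  Finset.measurable_fun_prod _ fun x hx => measurable_sign.comp (hf.measurable x (hS x hx))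

lemma integrable_prod_sign (hf : IsSzegoField P f) {S : Finset ℝ}
    (hS : ∀ x ∈ S, x ∈ Set.Ioo (-1 : ℝ) 1) :
    Integrable (fun ω => ∏ x ∈ S, Real.sign (f x ω)) P :=
  Integrable.of_bound (C := 1) (hf.measurable_prod_sign hS).aestronglyMeasurable
    (ae_of_all _ fun _ => abs_prod_sign_le _ _)

lemma integrable_sign_mul_prod_sign (hf : IsSzegoField P f) {t : ℝ}
    (ht : t ∈ Set.Ioo (-1 : ℝ) 1) {S : Finset ℝ} (hS : ∀ x ∈ S, x ∈ Set.Ioo (-1 : ℝ) 1) :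
    Integrable (fun ω => Real.sign (f t ω) * ∏ x ∈ S, Real.sign (f x ω)) P :=
  (hf.integrable_prod_sign hS).bdd_mul (c := 1)
    (measurable_sign.comp (hf.measurable t ht)).aestronglyMeasurable
    (ae_of_all _ fun _ => abs_sign_le _)

omit [IsProbabilityMeasure P] in
lemma measurable_field_fst (hf : IsSzegoField P f) {t : ℝ} (ht : t ∈ Set.Ioo (-1 : ℝ) 1) :
    Measurable fun p : Ω × ℝ => f t p.1 :=
  (hf.measurable t ht).comp measurable_fst

-- Fixing a zero at `t` multiplies the field by the Blaschke factor; only its deterministic sign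
-- survives in the product.
omit [MeasurableSpace Ω] in
lemma prod_sign_blaschke_mul {S : Finset ℝ} (hS : ∀ x ∈ S, x ∈ Set.Ioo (-1 : ℝ) 1) {t : ℝ}
    (ht : t ∈ Set.Ioo (-1 : ℝ) 1) (ω : Ω) :
    ∏ x ∈ S, Real.sign (blaschke t x * f x ω) =
      (∏ x ∈ S, Real.sign (x - t)) * ∏ x ∈ S, Real.sign (f x ω) := by
  rw [← Finset.prod_mul_distrib]
  exact Finset.prod_congr rfl fun x hx => by rw [sign_mul_real, sign_blaschke (hS x hx) ht]

/-- The derivative of a mean product of signs as one point moves. -/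
lemma hasDerivAt_signMean (hf : IsSzegoField P f) {t : ℝ} (ht : t ∈ Set.Ioo (-1 : ℝ) 1)
    {S : Finset ℝ} (hS : ∀ x ∈ S, x ∈ Set.Ioo (-1 : ℝ) 1) (htS : t ∉ S) :
    HasDerivAt (fun s => ∫ ω, Real.sign (f s ω) * ∏ x ∈ S, Real.sign (f x ω) ∂P)
      (2 * gaussianPDFReal 0 (varAt t) 0 * ((1 - t ^ 2)⁻¹ * (∏ x ∈ S, Real.sign (x - t)) *
        ∫ ω, f t ω * ∏ x ∈ S, Real.sign (f x ω) ∂P)) t := by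
  rw [hasDerivAt_iff_tendsto_slope_zero]
  have ht2 := one_sub_sq_pos ht
  obtain ⟨r, hr, hr1⟩ : ∃ r, |t| < r ∧ r < 1 := exists_between (abs_lt.2 ht)
  obtain ⟨M, hM, hMi, hfM⟩ := hf.exists_majorant r ⟨(abs_nonneg t).trans_lt hr, hr1⟩
  have hnear : ∀ᶠ h : ℝ in 𝓝[≠] 0, |t + h| < r := by
    have : Tendsto (fun h : ℝ => |t + h|) (𝓝 0) (𝓝 |t + 0|) :=
      (continuous_const.add continuous_id).abs.tendsto 0
    rw [add_zero] at this
    exact (this.eventually (gt_mem_nhds hr)).filter_mono nhdsWithin_le_nhds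
  have hmem : ∀ h : ℝ, |t + h| < r → t + h ∈ Set.Ioo (-1 : ℝ) 1 := fun h hh =>
    abs_lt.1 (hh.trans hr1)
  have key := tendsto_integral_sign_crossing (P := P) (varAt_ne_zero ht)
    (U := fun h ω => (1 - t ^ 2)⁻¹ * f (t + h) ω)
    (G := fun _ ω z => ∏ x ∈ S, Real.sign (z * regression t x + blaschke t x * f x ω))
    (U₀ := fun ω => (1 - t ^ 2)⁻¹ * f t ω)
    (G₀ := fun ω => ∏ x ∈ S, Real.sign (blaschke t x * f x ω))
    (M := fun ω => (1 - t ^ 2)⁻¹ * M ω) (hM.const_mul _) (hMi.const_mul _) ?_ ?_ ?_ ?_ ?_ ?_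
  · have elim : ∫ ω, (1 - t ^ 2)⁻¹ * f t ω * ∏ x ∈ S, Real.sign (blaschke t x * f x ω) ∂P =
        (1 - t ^ 2)⁻¹ * (∏ x ∈ S, Real.sign (x - t)) *
        ∫ ω, f t ω * ∏ x ∈ S, Real.sign (f x ω) ∂P := by
      rw [← integral_const_mul]
      refine integral_congr_ae (ae_of_all _ fun ω => ?_)
      simp only
      rw [prod_sign_blaschke_mul hS ht]
      ring
    rw [elim] at key
    refine key.congr' ?_
    filter_upwards [hnear] with h hh
    have hth := hmem h hh
    rw [smul_eq_mul, ← integral_sub (hf.integrable_sign_mul_prod_sign hth hS)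
      (hf.integrable_sign_mul_prod_sign ht hS)]
    congr 1
    have := hf.integral_eq_integral_prod ht (insert t (insert (t + h) S))
      (by
        intro x hx
        rw [Finset.mem_insert, Finset.mem_insert] at hx
        rcases hx with rfl | rfl | hx
        exacts [ht, hth, hS x hx])
      (fun v => Real.sign (v (t + h)) * ∏ x ∈ S, Real.sign (v x) -
        Real.sign (v t) * ∏ x ∈ S, Real.sign (v x))
      (by
        have h1 : Measurable fun v : ℝ → ℝ => ∏ x ∈ S, Real.sign (v x) :=
          Finset.measurable_fun_prod _ fun x _ => measurable_sign.comp (measurable_pi_apply x)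
        exact ((measurable_sign.comp (measurable_pi_apply _)).mul h1).sub
          ((measurable_sign.comp (measurable_pi_apply _)).mul h1))
      (by
        intro v w hvw
        rw [hvw t (by simp), hvw (t + h) (by simp), Finset.prod_congr rfl fun x hx => by
          rw [hvw x (by simp [hx])]])
    rw [this]
    refine integral_congr_ae (ae_of_all _ fun p => ?_)
    simp only [regression_self ht, blaschke_self, zero_mul, add_zero, mul_one]
    rw [← sub_mul]
    congr 2
    have hd := one_sub_mul_pos hth ht
    -- Dividing `z r + b f(t + h)` by `r > 0` keeps its sign, and `b / r = h / (1 - t²)`. This is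
    -- the source of the factor `(1 - t²)⁻¹` in `U`.
    rw [← sign_pos_mul (regression_pos hth ht)]
    congr 1
    unfold regression blaschke
    field_simp
    ring
  · filter_upwards [hnear] with h hh
    exact (hf.measurable _ (hmem h hh)).const_mul _
  · filter_upwards [hnear] with h hh ω
    rw [abs_mul, abs_of_pos (inv_pos.2 ht2)]
    exact mul_le_mul_of_nonneg_left (hfM ω _ hh.le) (inv_pos.2 ht2).le
  · intro ω
    refine Tendsto.const_mul _ ?_
    have h1 : Tendsto (fun h : ℝ => t + h) (𝓝[≠] 0) (𝓝 t) := by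
      have : Tendsto (fun h : ℝ => t + h) (𝓝 0) (𝓝 (t + 0)) :=
        (continuous_const.add continuous_id).tendsto 0
      rw [add_zero] at this
      exact this.mono_left nhdsWithin_le_nhds
    exact (hf.continuousAt ω t ht).tendsto.comp h1
  · refine Eventually.of_forall fun h => Finset.measurable_fun_prod _ fun x hx =>
      measurable_sign.comp ?_
    exact (measurable_snd.mul_const _).add ((hf.measurable_field_fst (hS x hx)).const_mul _)
  · exact Eventually.of_forall fun h ω z => abs_prod_sign_le _ _
  · have hne : ∀ᵐ ω ∂P, ∀ x ∈ S, f x ω ≠ 0 :=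
      (ae_ball_iff S.countable_toSet).2 fun x hx => hf.ae_ne_zero (hS x hx)
    filter_upwards [hne] with ω hω z
    refine tendsto_finsetProd _ fun x hx => tendsto_sign ?_ ?_
    · exact mul_ne_zero (blaschke_ne_zero (hS x hx) ht fun e => htS (e ▸ hx)) (hω x hx)
    · have : Tendsto (fun ε : ℝ => ε * z * regression t x + blaschke t x * f x ω) (𝓝 0)
          (𝓝 (0 * z * regression t x + blaschke t x * f x ω)) :=
        (((continuous_id.mul continuous_const).mul continuous_const).add
          continuous_const).tendsto 0
      rw [zero_mul, zero_mul, zero_add] at this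
      exact this.mono_left nhdsWithin_le_nhds

end IsSzegoField

end

/-! ### Gaussian integration by parts for a product of signs -/

section

open Filter Topology

namespace IsSzegoField

variable {Ω : Type*} [MeasurableSpace Ω] {P : Measure Ω} [IsProbabilityMeasure P] {f : ℝ → Ω → ℝ}

/-- Translating the field by `ε r` is the same as translating the independent Gaussian value `z` by
`ε` in the decomposition at `t`. Integration by parts in the single variable `z` then suffices,
after averaging over the residual field. -/
lemma hasDerivAt_integral_prod_sign_shift (hf : IsSzegoField P f) {t : ℝ}
    (ht : t ∈ Set.Ioo (-1 : ℝ) 1) {S : Finset ℝ} (hS : ∀ x ∈ S, x ∈ Set.Ioo (-1 : ℝ) 1) :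
    HasDerivAt (fun ε => ∫ ω, ∏ x ∈ S, Real.sign (f x ω + ε * regression t x) ∂P)
      ((covKernel t t)⁻¹ * ∫ ω, f t ω * ∏ x ∈ S, Real.sign (f x ω) ∂P) 0 := by
  let H : Ω × ℝ → ℝ := fun p =>
    ∏ x ∈ S, Real.sign (p.2 * regression t x + blaschke t x * f x p.1)
  have hH : Measurable H := Finset.measurable_fun_prod _ fun x hx => measurable_sign.comp
    ((measurable_snd.mul_const _).add ((hf.measurable_field_fst (hS x hx)).const_mul _))
  have hH1 : ∀ p, |H p| ≤ 1 := fun p => abs_prod_sign_le _ _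
  let h : ℝ → ℝ := fun z => ∫ ω, H (ω, z) ∂P
  have hm : Measurable h := hH.stronglyMeasurable.integral_prod_left'.measurable
  have hh1 : ∀ z, |h z| ≤ 1 := fun z => by
    have := norm_integral_le_of_norm_le_const (μ := P) (f := fun ω => H (ω, z)) (C := 1)
      (ae_of_all _ fun ω => hH1 _)
    simpa using this
  have key := hasDerivAt_integral_gaussianReal_add (varAt_ne_zero ht) hm hh1
  rw [coe_varAt ht] at key
  have hT : ∀ x ∈ insert t S, x ∈ Set.Ioo (-1 : ℝ) 1 := by
    intro x hx
    rcases Finset.mem_insert.1 hx with rfl | hx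
    exacts [ht, hS x hx]
  have e1 : ∀ ε, ∫ ω, ∏ x ∈ S, Real.sign (f x ω + ε * regression t x) ∂P =
      ∫ z, h (z + ε) ∂(gaussianReal 0 (varAt t)) := by
    intro ε
    rw [hf.integral_eq_integral_prod ht S hS
      (fun v => ∏ x ∈ S, Real.sign (v x + ε * regression t x))
      (Finset.measurable_fun_prod _ fun x _ => measurable_sign.comp
        ((measurable_pi_apply x).add_const _))
      (fun v w hvw => Finset.prod_congr rfl fun x hx => by rw [hvw x hx])]
    have hm' : Measurable fun p : Ω × ℝ => H (p.1, p.2 + ε) :=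
      hH.comp (measurable_fst.prodMk (measurable_snd.add_const _))
    have := integral_prod_symm (μ := P) (ν := gaussianReal 0 (varAt t))
      (fun p : Ω × ℝ => H (p.1, p.2 + ε)) (Integrable.of_bound (C := 1) hm'.aestronglyMeasurable
        (ae_of_all _ fun p => hH1 _))
    rw [← this]
    refine integral_congr_ae (ae_of_all _ fun p => Finset.prod_congr rfl fun x _ => ?_)
    congr 1
    ring
  have e2 : ∫ ω, f t ω * ∏ x ∈ S, Real.sign (f x ω) ∂P =
      ∫ z, z * h z ∂(gaussianReal 0 (varAt t)) := by
    rw [hf.integral_eq_integral_prod ht (insert t S) hT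
      (fun v => v t * ∏ x ∈ S, Real.sign (v x))
      ((measurable_pi_apply t).mul (Finset.measurable_fun_prod _ fun x _ =>
        measurable_sign.comp (measurable_pi_apply x)))
      (fun v w hvw => by
        rw [hvw t (by simp), Finset.prod_congr rfl fun x hx => by rw [hvw x (by simp [hx])]])]
    simp only [regression_self ht, blaschke_self, zero_mul, add_zero, mul_one]
    have hz : Integrable (fun z : ℝ => z) (gaussianReal 0 (varAt t)) :=
      (memLp_id_gaussianReal 1).integrable (by simp)
    have := integral_prod_symm (μ := P) (ν := gaussianReal 0 (varAt t))
      (fun p : Ω × ℝ => p.2 * H p) (((hz.comp_snd P).bdd_mul (c := 1) hH.aestronglyMeasurable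
        (ae_of_all _ fun p => hH1 _)).congr (ae_of_all _ fun p => mul_comm _ _))
    rw [this]
    simp only [h, integral_const_mul]
  simp only [e1, e2]
  exact key

/-- The expectation of a linear functional times a product of signs. -/
lemma integral_mul_prod_sign (hf : IsSzegoField P f) {t : ℝ}
    (ht : t ∈ Set.Ioo (-1 : ℝ) 1) {S : Finset ℝ} (hS : ∀ x ∈ S, x ∈ Set.Ioo (-1 : ℝ) 1) :
    ∫ ω, f t ω * ∏ x ∈ S, Real.sign (f x ω) ∂P =
      ∑ y ∈ S, 2 * gaussianPDFReal 0 (varAt y) 0 * (covKernel y t *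
        ((∏ x ∈ S.erase y, Real.sign (x - y)) * signMean P f (S.erase y))) := by
  have key := hasDerivAt_iff_tendsto_slope_zero.1 (hf.hasDerivAt_integral_prod_sign_shift ht hS)
  -- Telescoping: the shift is switched on one factor at a time in the order of the real line, so
  -- factors left of `y` are already shifted and those right of `y` are not.
  let D : ℝ → ℝ → Ω → ℝ := fun y ε ω =>
    (Real.sign (f y ω + ε * regression t y) - Real.sign (f y ω)) *
      ((∏ x ∈ S with x < y, Real.sign (f x ω + ε * regression t x)) *
      ∏ x ∈ S with y < x, Real.sign (f x ω))
  have hDm : ∀ y ∈ S, ∀ ε, Measurable (D y ε) := by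
    intro y hy ε
    have h1 : ∀ x ∈ S, Measurable fun ω => Real.sign (f x ω + ε * regression t x) :=
      fun x hx => measurable_sign.comp ((hf.measurable x (hS x hx)).add_const _)
    have h2 : ∀ x ∈ S, Measurable fun ω => Real.sign (f x ω) :=
      fun x hx => measurable_sign.comp (hf.measurable x (hS x hx))
    exact ((h1 y hy).sub (h2 y hy)).mul
      ((Finset.measurable_fun_prod _ fun x hx => h1 x (Finset.mem_filter.1 hx).1).mul
      (Finset.measurable_fun_prod _ fun x hx => h2 x (Finset.mem_filter.1 hx).1))
  have hDi : ∀ y ∈ S, ∀ ε, Integrable (D y ε) P := by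
    intro y hy ε
    refine Integrable.of_bound (C := 2 * (1 * 1)) (hDm y hy ε).aestronglyMeasurable
      (ae_of_all _ fun ω => ?_)
    rw [Real.norm_eq_abs, abs_mul, abs_mul]
    refine mul_le_mul ?_ (mul_le_mul (abs_prod_sign_le _ _) (abs_prod_sign_le _ _)
      (abs_nonneg _) zero_le_one) (by positivity) zero_le_two
    calc _ ≤ |Real.sign (f y ω + ε * regression t y)| + |Real.sign (f y ω)| := abs_sub _ _
      _ ≤ 2 := by linarith [abs_sign_le (f y ω + ε * regression t y), abs_sign_le (f y ω)]
  have hlim : ∀ y ∈ S, Tendsto (fun ε => ε⁻¹ * ∫ ω, D y ε ω ∂P) (𝓝[≠] 0)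
      (𝓝 (2 * gaussianPDFReal 0 (varAt y) 0 * (regression t y *
        ((∏ x ∈ S.erase y, Real.sign (x - y)) * signMean P f (S.erase y))))) := by
    intro y hy
    have hyI := hS y hy
    -- In the term of `y` only the sign of `f y` changes, so the conditioning is on `f y`; the shift
    -- still present in the other factors disappears in the limit.
    have hU := tendsto_integral_sign_crossing (P := P) (varAt_ne_zero hyI)
      (U := fun _ _ => regression t y)
      (G := fun ε ω z =>
        (∏ x ∈ S with x < y, Real.sign (z * regression y x + blaschke y x * f x ω +
          ε * regression t x)) *
        ∏ x ∈ S with y < x, Real.sign (z * regression y x + blaschke y x * f x ω))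
      (U₀ := fun _ => regression t y)
      (G₀ := fun ω => ∏ x ∈ S.erase y, Real.sign (blaschke y x * f x ω))
      (M := fun _ => |regression t y|) measurable_const (integrable_const _)
      (Eventually.of_forall fun _ => measurable_const)
      (Eventually.of_forall fun _ _ => le_rfl) (fun _ => tendsto_const_nhds) ?_ ?_ ?_
    · have hSe : ∀ x ∈ S.erase y, x ∈ Set.Ioo (-1 : ℝ) 1 := fun x hx =>
        hS x (Finset.mem_of_mem_erase hx)
      have elim : ∫ ω, regression t y * ∏ x ∈ S.erase y, Real.sign (blaschke y x * f x ω) ∂P =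
          regression t y *
          ((∏ x ∈ S.erase y, Real.sign (x - y)) * signMean P f (S.erase y)) := by
        simp only [prod_sign_blaschke_mul hSe hyI, integral_const_mul, signMean]
      rw [elim] at hU
      refine hU.congr fun ε => ?_
      congr 1
      have := hf.integral_eq_integral_prod hyI S hS
        (fun v => (Real.sign (v y + ε * regression t y) - Real.sign (v y)) *
          ((∏ x ∈ S with x < y, Real.sign (v x + ε * regression t x)) *
          ∏ x ∈ S with y < x, Real.sign (v x)))
        (by
          have h1 : ∀ x, Measurable fun v : ℝ → ℝ => Real.sign (v x + ε * regression t x) :=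
            fun x => measurable_sign.comp ((measurable_pi_apply x).add_const _)
          have h2 : ∀ x, Measurable fun v : ℝ → ℝ => Real.sign (v x) :=
            fun x => measurable_sign.comp (measurable_pi_apply x)
          exact ((h1 y).sub (h2 y)).mul ((Finset.measurable_fun_prod _ fun x _ => h1 x).mul
            (Finset.measurable_fun_prod _ fun x _ => h2 x)))
        (by
          intro v w hvw
          rw [hvw y hy, Finset.prod_congr rfl fun x hx => by
              rw [hvw x (Finset.mem_filter.1 hx).1],
            Finset.prod_congr (s₁ := S.filter (y < ·)) rfl fun x hx => by
              rw [hvw x (Finset.mem_filter.1 hx).1]])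
      simp only [D, this]
      simp only [regression_self hyI, blaschke_self, zero_mul, add_zero, mul_one]
    · refine Eventually.of_forall fun ε => ?_
      have h0 : ∀ x ∈ S, Measurable fun p : Ω × ℝ =>
          p.2 * regression y x + blaschke y x * f x p.1 := fun x hx =>
        (measurable_snd.mul_const _).add ((hf.measurable_field_fst (hS x hx)).const_mul _)
      exact (Finset.measurable_fun_prod _ fun x hx => measurable_sign.comp
          ((h0 x (Finset.mem_filter.1 hx).1).add_const _)).mul
        (Finset.measurable_fun_prod _ fun x hx => measurable_sign.comp
          (h0 x (Finset.mem_filter.1 hx).1))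
    · refine Eventually.of_forall fun ε ω z => ?_
      rw [abs_mul]
      exact mul_le_one₀ (abs_prod_sign_le _ _) (abs_nonneg _) (abs_prod_sign_le _ _)
    · have hne : ∀ᵐ ω ∂P, ∀ x ∈ S, f x ω ≠ 0 :=
        (ae_ball_iff S.countable_toSet).2 fun x hx => hf.ae_ne_zero (hS x hx)
      filter_upwards [hne] with ω hω z
      have hsplit : ∏ x ∈ S.erase y, Real.sign (blaschke y x * f x ω) =
          (∏ x ∈ S with x < y, Real.sign (blaschke y x * f x ω)) *
            ∏ x ∈ S with y < x, Real.sign (blaschke y x * f x ω) := by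
        rw [← Finset.prod_union]
        · refine Finset.prod_congr ?_ fun _ _ => rfl
          ext x
          simp only [Finset.mem_erase, Finset.mem_union, Finset.mem_filter]
          constructor
          · rintro ⟨h1, h2⟩
            exact (lt_or_gt_of_ne h1).imp (fun h => ⟨h2, h⟩) (fun h => ⟨h2, h⟩)
          · rintro (⟨h1, h2⟩ | ⟨h1, h2⟩)
            exacts [⟨h2.ne, h1⟩, ⟨h2.ne', h1⟩]
        · exact Finset.disjoint_filter.2 fun x _ h1 h2 => lt_asymm h1 h2
      rw [hsplit]
      have hn0 : ∀ x ∈ S, x ≠ y → blaschke y x * f x ω ≠ 0 := fun x hx hxy =>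
        mul_ne_zero (blaschke_ne_zero (hS x hx) hyI hxy) (hω x hx)
      refine Tendsto.mul (tendsto_finsetProd _ fun x hx => ?_)
        (tendsto_finsetProd _ fun x hx => ?_)
      · rw [Finset.mem_filter] at hx
        refine tendsto_sign (hn0 x hx.1 hx.2.ne) ?_
        have : Tendsto (fun ε : ℝ => ε * z * regression y x + blaschke y x * f x ω +
            ε * regression t x) (𝓝 0)
            (𝓝 (0 * z * regression y x + blaschke y x * f x ω + 0 * regression t x)) :=
          Continuous.tendsto (by fun_prop) 0
        rw [zero_mul, zero_mul, zero_add, zero_mul, add_zero] at this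
        exact this.mono_left nhdsWithin_le_nhds
      · rw [Finset.mem_filter] at hx
        refine tendsto_sign (hn0 x hx.1 hx.2.ne') ?_
        have : Tendsto (fun ε : ℝ => ε * z * regression y x + blaschke y x * f x ω) (𝓝 0)
            (𝓝 (0 * z * regression y x + blaschke y x * f x ω)) :=
          Continuous.tendsto (by fun_prop) 0
        rw [zero_mul, zero_mul, zero_add] at this
        exact this.mono_left nhdsWithin_le_nhds
  have hsum := tendsto_finsetSum S hlim
  have heq : (covKernel t t)⁻¹ * ∫ ω, f t ω * ∏ x ∈ S, Real.sign (f x ω) ∂P =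
      ∑ y ∈ S, 2 * gaussianPDFReal 0 (varAt y) 0 * (regression t y *
        ((∏ x ∈ S.erase y, Real.sign (x - y)) * signMean P f (S.erase y))) := by
    -- The same difference quotient has been computed twice: by integration by parts, and crossing
    -- by crossing.
    refine tendsto_nhds_unique (key.congr fun ε => ?_) hsum
    rw [smul_eq_mul, ← Finset.mul_sum, ← integral_finsetSum _ fun y hy => hDi y hy ε]
    congr 1
    simp only [zero_add, zero_mul, add_zero]
    rw [← integral_sub]
    · refine integral_congr_ae (ae_of_all _ fun ω => ?_)
      have := Finset.prod_add_ordered S (fun x => Real.sign (f x ω))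
        (fun x => Real.sign (f x ω + ε * regression t x) - Real.sign (f x ω))
      simp only [add_sub_cancel] at this
      simp only [this, add_sub_cancel_left, D, mul_assoc]
    · refine Integrable.of_bound (C := 1) (Measurable.aestronglyMeasurable ?_)
        (ae_of_all _ fun _ => abs_prod_sign_le _ _)
      exact Finset.measurable_fun_prod _ fun x hx => measurable_sign.comp
        ((hf.measurable x (hS x hx)).add_const _)
    · exact hf.integrable_prod_sign hS
  have hK := covKernel_pos ht ht
  rw [inv_mul_eq_iff_eq_mul₀ hK.ne'] at heq
  rw [heq, Finset.mul_sum]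
  refine Finset.sum_congr rfl fun y hy => ?_
  have : covKernel t t * regression t y = covKernel y t := by
    have h1 := one_sub_mul_pos ht ht
    have h1' := one_sub_sq_pos ht
    have h2 := one_sub_mul_pos (hS y hy) ht
    unfold covKernel regression
    field_simp
  rw [← this]
  ring

end IsSzegoField

end

/-! ### The arcsine kernel, the boundary limit at `-1`, and the expansion along the leftmost point
-/

section

open Filter Topology

lemma corr_eq {s t : ℝ} (hs : s ∈ Set.Ioo (-1 : ℝ) 1) (ht : t ∈ Set.Ioo (-1 : ℝ) 1) :
    corr s t = √(1 - s ^ 2) * √(1 - t ^ 2) / (1 - s * t) := by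
  have h1 := one_sub_sq_pos hs
  have h2 := one_sub_sq_pos ht
  have h3 := one_sub_mul_pos hs ht
  unfold corr covKernel
  rw [← sq, ← sq, one_div_mul_one_div, one_div, one_div, Real.sqrt_inv, Real.sqrt_mul h1.le,
    div_inv_eq_mul, inv_mul_eq_div]

lemma corr_comm (s t : ℝ) : corr s t = corr t s := by
  unfold corr; rw [covKernel_comm s t, mul_comm]

/-- Since `1 - c²` is the square of the Blaschke factor, the root in the derivative of the arcsine
is rational. The assumption `t < y` fixes its sign and keeps `c` away from `±1`. -/
lemma hasDerivAt_arcsin_corr {t y : ℝ} (ht : t ∈ Set.Ioo (-1 : ℝ) 1)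
    (hy : y ∈ Set.Ioo (-1 : ℝ) 1) (hty : t < y) :
    HasDerivAt (fun s => Real.arcsin (corr s y))
      (√(1 - y ^ 2) / (√(1 - t ^ 2) * (1 - t * y))) t := by
  have h1 := one_sub_sq_pos ht
  have h2 := one_sub_sq_pos hy
  have h3 := one_sub_mul_pos ht hy
  have q1 := Real.sqrt_pos.2 h1
  have q2 := Real.sqrt_pos.2 h2
  have e1 := Real.sq_sqrt h1.le
  have e2 := Real.sq_sqrt h2.le
  have hc : HasDerivAt (fun s => √(1 - s ^ 2) * √(1 - y ^ 2) / (1 - s * y))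
      (√(1 - y ^ 2) * (y - t) / (√(1 - t ^ 2) * (1 - t * y) ^ 2)) t := by
    have d1 : HasDerivAt (fun s : ℝ => 1 - s ^ 2) (-(2 * t)) t := by
      simpa using ((hasDerivAt_id t).pow 2).const_sub 1
    have d2 : HasDerivAt (fun s : ℝ => 1 - s * y) (-y) t := by
      simpa using ((hasDerivAt_id t).mul_const y).const_sub 1
    refine (((d1.sqrt h1.ne').mul_const (√(1 - y ^ 2))).div d2 h3.ne').congr_deriv ?_
    field_simp
    rw [e1]
    ring
  have hsq : 1 - (√(1 - t ^ 2) * √(1 - y ^ 2) / (1 - t * y)) ^ 2 =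
      ((y - t) / (1 - t * y)) ^ 2 := by
    rw [div_pow, mul_pow, e1, e2]
    field_simp
    ring
  have hlt : 0 < 1 - (√(1 - t ^ 2) * √(1 - y ^ 2) / (1 - t * y)) ^ 2 := by
    rw [hsq]; exact pow_pos (div_pos (sub_pos.2 hty) h3) 2
  have hne1 : √(1 - t ^ 2) * √(1 - y ^ 2) / (1 - t * y) ≠ -1 := by
    intro h; rw [h] at hlt; norm_num at hlt
  have hne2 : √(1 - t ^ 2) * √(1 - y ^ 2) / (1 - t * y) ≠ 1 := by
    intro h; rw [h] at hlt; norm_num at hlt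
  have hd := (Real.hasDerivAt_arcsin hne1 hne2).comp t hc
  have hev : (fun s => Real.arcsin (corr s y)) =ᶠ[𝓝 t]
      (Real.arcsin ∘ fun s => √(1 - s ^ 2) * √(1 - y ^ 2) / (1 - s * y)) := by
    filter_upwards [isOpen_Ioo.mem_nhds ht] with s hs
    simp only [Function.comp, corr_eq hs hy]
  refine (hd.congr_of_eventuallyEq hev).congr_deriv ?_
  have hyt : 0 < y - t := sub_pos.2 hty
  rw [hsq, Real.sqrt_sq (div_pos hyt h3).le]
  field_simp

lemma tendsto_arcsin_corr {y : ℝ} (hy : y ∈ Set.Ioo (-1 : ℝ) 1) :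
    Tendsto (fun s => Real.arcsin (corr s y)) (𝓝[>] (-1)) (𝓝 0) := by
  have h : Tendsto (fun s => Real.arcsin (√(1 - s ^ 2) * √(1 - y ^ 2) / (1 - s * y))) (𝓝 (-1))
      (𝓝 (Real.arcsin (√(1 - (-1) ^ 2) * √(1 - y ^ 2) / (1 - (-1) * y)))) := by
    refine (Real.continuous_arcsin.tendsto _).comp (Tendsto.div ?_ ?_ ?_)
    · exact Continuous.tendsto (by fun_prop) _
    · exact Continuous.tendsto (by fun_prop) _
    · have := hy.1
      intro h; linarith
  have h0 : Real.arcsin (√(1 - (-1) ^ 2) * √(1 - y ^ 2) / (1 - (-1) * y)) = 0 := by simp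
  rw [h0] at h
  refine (h.mono_left nhdsWithin_le_nhds).congr' ?_
  filter_upwards [Ioo_mem_nhdsGT (show (-1 : ℝ) < 1 by norm_num)] with s hs
  rw [corr_eq hs hy]

lemma gaussianPDFReal_varAt_zero {t : ℝ} (ht : t ∈ Set.Ioo (-1 : ℝ) 1) :
    gaussianPDFReal 0 (varAt t) 0 = √(1 - t ^ 2) / √(2 * Real.pi) := by
  have h1 := one_sub_sq_pos ht
  rw [gaussianPDFReal, coe_varAt ht, covKernel, ← sq]
  simp only [sub_zero, ne_eq, OfNat.ofNat_ne_zero, not_false_eq_true, zero_pow, neg_zero, zero_div,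
    Real.exp_zero, mul_one]
  rw [mul_one_div, Real.sqrt_div (by positivity), inv_div]

lemma integral_sign_gaussianReal (v : NNReal) : ∫ z, Real.sign z ∂(gaussianReal 0 v) = 0 := by
  have h := integral_map (μ := gaussianReal 0 v) (φ := fun x : ℝ => -x) (by fun_prop)
    (f := Real.sign) measurable_sign.aestronglyMeasurable
  rw [gaussianReal_map_neg, neg_zero] at h
  simp only [Real.sign_neg, integral_neg] at h
  linarith

namespace IsSzegoField

variable {Ω : Type*} [MeasurableSpace Ω] {P : Measure Ω} [IsProbabilityMeasure P] {f : ℝ → Ω → ℝ}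

/-- The sign of `f t` becomes independent of the remaining field as `t` tends to `-1`. -/
lemma tendsto_signMean_left (hf : IsSzegoField P f) {S : Finset ℝ}
    (hS : ∀ x ∈ S, x ∈ Set.Ioo (-1 : ℝ) 1) :
    Tendsto (fun s => ∫ ω, Real.sign (f s ω) * ∏ x ∈ S, Real.sign (f x ω) ∂P) (𝓝[>] (-1))
      (𝓝 0) := by
  -- The value of `f t` is normalised to unit variance, so the measure no longer depends on `t`.
  -- Although the variance blows up at `-1`, its root times the regression coefficient is `√(1 -
  -- t²)/(1 - x t) → 0`, while the Blaschke factor tends to one.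
  let H : ℝ → Ω × ℝ → ℝ := fun t p => Real.sign p.2 * ∏ x ∈ S,
    Real.sign (√(covKernel t t) * p.2 * regression t x + blaschke t x * f x p.1)
  have hH : ∀ t, Measurable (H t) := fun t =>
    (measurable_sign.comp measurable_snd).mul (Finset.measurable_fun_prod _ fun x hx =>
      measurable_sign.comp (((measurable_snd.const_mul _).mul_const _).add
        ((hf.measurable_field_fst (hS x hx)).const_mul _)))
  have hH1 : ∀ t p, ‖H t p‖ ≤ 1 := fun t p => by
    rw [Real.norm_eq_abs, abs_mul]
    exact mul_le_one₀ (abs_sign_le _) (abs_nonneg _) (abs_prod_sign_le _ _)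
  have hI : Set.Ioo (-1 : ℝ) 1 ∈ 𝓝[>] (-1 : ℝ) := Ioo_mem_nhdsGT (by norm_num)
  have e : ∀ t ∈ Set.Ioo (-1 : ℝ) 1, ∫ p, H t p ∂(P.prod (gaussianReal 0 1)) =
      ∫ ω, Real.sign (f t ω) * ∏ x ∈ S, Real.sign (f x ω) ∂P := by
    intro t ht
    have hK := covKernel_pos ht ht
    rw [hf.integral_eq_integral_prod ht (insert t S) (by
        intro x hx
        rcases Finset.mem_insert.1 hx with rfl | hx
        exacts [ht, hS x hx])
      (fun v => Real.sign (v t) * ∏ x ∈ S, Real.sign (v x))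
      ((measurable_sign.comp (measurable_pi_apply t)).mul (Finset.measurable_fun_prod _ fun x _ =>
        measurable_sign.comp (measurable_pi_apply x)))
      (fun v w hvw => by
        rw [hvw t (by simp), Finset.prod_congr rfl fun x hx => by rw [hvw x (by simp [hx])]])]
    simp only [regression_self ht, blaschke_self, zero_mul, add_zero, mul_one]
    have hmap : gaussianReal 0 (varAt t) =
        (gaussianReal 0 1).map (fun z => √(covKernel t t) * z) := by
      rw [gaussianReal_map_const_mul, mul_zero, mul_one]
      congr 1
      ext
      rw [coe_varAt ht]
      exact (Real.sq_sqrt hK.le).symm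
    have hprod : P.prod (gaussianReal 0 (varAt t)) = (P.prod (gaussianReal 0 1)).map
        (Prod.map id fun z => √(covKernel t t) * z) := by
      rw [hmap, ← Measure.map_prod_map _ _ measurable_id (by fun_prop), Measure.map_id]
    rw [hprod, integral_map (by fun_prop)]
    · refine integral_congr_ae (ae_of_all _ fun p => ?_)
      simp only [H, Prod.map, id]
      rw [sign_pos_mul (Real.sqrt_pos.2 hK)]
    · refine Measurable.aestronglyMeasurable ?_
      exact (measurable_sign.comp measurable_snd).mul (Finset.measurable_fun_prod _ fun x hx =>
        measurable_sign.comp ((measurable_snd.mul_const _).add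
        ((hf.measurable_field_fst (hS x hx)).const_mul _)))
  have hlim : ∀ᵐ p ∂(P.prod (gaussianReal 0 1)), Tendsto (fun t => H t p) (𝓝[>] (-1))
      (𝓝 (Real.sign p.2 * ∏ x ∈ S, Real.sign (f x p.1))) := by
    have hne : ∀ᵐ ω ∂P, ∀ x ∈ S, f x ω ≠ 0 :=
      (ae_ball_iff S.countable_toSet).2 fun x hx => hf.ae_ne_zero (hS x hx)
    filter_upwards [Measure.quasiMeasurePreserving_fst.ae hne] with p hp
    refine tendsto_const_nhds.mul (tendsto_finsetProd _ fun x hx => tendsto_sign (hp x hx) ?_)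
    have hx1 : 1 - x * (-1) ≠ 0 := by
      have := (hS x hx).1
      intro h; linarith
    have h0 : Tendsto (fun t : ℝ => √(1 - t ^ 2) / (1 - x * t) * p.2 +
        (x - t) / (1 - x * t) * f x p.1) (𝓝 (-1)) (𝓝 (√(1 - (-1) ^ 2) / (1 - x * (-1)) * p.2 +
        (x - (-1)) / (1 - x * (-1)) * f x p.1)) := by
      refine Tendsto.add (Tendsto.mul_const _ (Tendsto.div ?_ ?_ hx1))
        (Tendsto.mul_const _ (Tendsto.div ?_ ?_ hx1)) <;>
      exact Continuous.tendsto (by fun_prop) _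
    have h1 : √(1 - (-1) ^ 2) / (1 - x * (-1)) * p.2 +
        (x - (-1)) / (1 - x * (-1)) * f x p.1 = f x p.1 := by
      rw [show x - (-1) = 1 - x * (-1) by ring, div_self hx1]
      simp
    rw [h1] at h0
    refine (h0.mono_left nhdsWithin_le_nhds).congr' ?_
    filter_upwards [hI] with t ht
    have h2 := one_sub_sq_pos ht
    have h3 := Real.sqrt_pos.2 h2
    have h4 := Real.sq_sqrt h2.le
    rw [blaschke, regression, covKernel, ← sq, one_div, Real.sqrt_inv]
    congr 1
    have h5 : (1 - t ^ 2) / (1 - x * t) = √(1 - t ^ 2) * (√(1 - t ^ 2) / (1 - x * t)) := by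
      rw [← mul_div_assoc, ← sq, h4]
    rw [h5]
    field_simp
  have hT := tendsto_integral_filter_of_dominated_convergence (l := 𝓝[>] (-1 : ℝ))
    (μ := P.prod (gaussianReal 0 1)) (fun _ => (1 : ℝ))
    (Eventually.of_forall fun t => (hH t).aestronglyMeasurable)
    (Eventually.of_forall fun t => ae_of_all _ (hH1 t)) (integrable_const _) hlim
  have hz : ∫ p : Ω × ℝ, Real.sign p.2 * ∏ x ∈ S, Real.sign (f x p.1)
      ∂(P.prod (gaussianReal 0 1)) = 0 := by
    have := integral_prod_mul (μ := P) (ν := gaussianReal 0 1)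
      (fun ω => ∏ x ∈ S, Real.sign (f x ω)) Real.sign
    rw [integral_sign_gaussianReal, mul_zero] at this
    refine Eq.trans ?_ this
    exact integral_congr_ae (ae_of_all _ fun p => mul_comm _ _)
  rw [hz] at hT
  refine hT.congr' ?_
  filter_upwards [hI] with t ht using e t ht

/-- Expansion of a mean product of signs along its leftmost point. -/
lemma signMean_expansion (hf : IsSzegoField P f) {t : ℝ} (ht : t ∈ Set.Ioo (-1 : ℝ) 1)
    {S : Finset ℝ} (hS : ∀ x ∈ S, x ∈ Set.Ioo (-1 : ℝ) 1) (htS : ∀ x ∈ S, t < x) :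
    ∫ ω, Real.sign (f t ω) * ∏ x ∈ S, Real.sign (f x ω) ∂P =
      ∑ y ∈ S, 2 / Real.pi * Real.arcsin (corr t y) *
        ((∏ x ∈ S.erase y, Real.sign (x - y)) * signMean P f (S.erase y)) := by
  let A : ℝ → ℝ := fun s => ∫ ω, Real.sign (f s ω) * ∏ x ∈ S, Real.sign (f x ω) ∂P
  let B : ℝ → ℝ := fun s => ∑ y ∈ S, 2 / Real.pi * Real.arcsin (corr s y) *
        ((∏ x ∈ S.erase y, Real.sign (x - y)) * signMean P f (S.erase y))
  -- On `(-1, m)` the moving point stays left of `S`: it meets no point of `S`, and every `sgn(x -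
  -- s)` is one.
  obtain ⟨m, htm, hm1, hmS⟩ : ∃ m, t < m ∧ m ≤ 1 ∧ ∀ x ∈ S, m ≤ x := by
    rcases S.eq_empty_or_nonempty with rfl | hne
    · exact ⟨1, ht.2, le_rfl, by simp⟩
    · exact ⟨S.min' hne, htS _ (S.min'_mem hne), (hS _ (S.min'_mem hne)).2.le,
        fun x hx => S.min'_le x hx⟩
  have hd : ∀ s ∈ Set.Ioo (-1) m, HasDerivAt (fun s => A s - B s) 0 s := by
    intro s hs
    have hsI : s ∈ Set.Ioo (-1 : ℝ) 1 := ⟨hs.1, hs.2.trans_le hm1⟩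
    have hsS : ∀ x ∈ S, s < x := fun x hx => hs.2.trans_le (hmS x hx)
    have h1 := hf.hasDerivAt_signMean hsI hS (fun h => lt_irrefl _ (hsS s h))
    have h2 : HasDerivAt B (∑ y ∈ S, 2 / Real.pi *
        (√(1 - y ^ 2) / (√(1 - s ^ 2) * (1 - s * y))) *
        ((∏ x ∈ S.erase y, Real.sign (x - y)) * signMean P f (S.erase y))) s :=
      HasDerivAt.fun_sum fun y hy =>
        ((hasDerivAt_arcsin_corr hsI (hS y hy) (hsS y hy)).const_mul _).mul_const _
    refine (h1.sub h2).congr_deriv (sub_eq_zero.2 ?_)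
    have hp : ∏ x ∈ S, Real.sign (x - s) = 1 :=
      Finset.prod_eq_one fun x hx => Real.sign_of_pos (sub_pos.2 (hsS x hx))
    rw [hf.integral_mul_prod_sign hsI hS, hp, mul_one, Finset.mul_sum, Finset.mul_sum]
    refine Finset.sum_congr rfl fun y hy => ?_
    have hy2 := one_sub_sq_pos (hS y hy)
    have hs2 := one_sub_sq_pos hsI
    have hys := one_sub_mul_pos hsI (hS y hy)
    have q1 := Real.sqrt_pos.2 hs2
    have e1 := Real.sq_sqrt hs2.le
    have e3 := Real.sq_sqrt Real.two_pi_pos.le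
    have q3 := Real.sqrt_pos.2 Real.two_pi_pos
    rw [gaussianPDFReal_varAt_zero hsI, gaussianPDFReal_varAt_zero (hS y hy), covKernel,
      mul_comm y s]
    -- The two Gaussian densities at zero, one from each sign crossing, give `2 · 2 / (2π) = 2/π`.
    have : 2 * (√(1 - s ^ 2) / √(2 * Real.pi)) * ((1 - s ^ 2)⁻¹ *
        (2 * (√(1 - y ^ 2) / √(2 * Real.pi)) * (1 / (1 - s * y)))) =
        2 / Real.pi * (√(1 - y ^ 2) / (√(1 - s ^ 2) * (1 - s * y))) := by
      rw [← e1, Real.sqrt_sq q1.le]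
      field_simp
      rw [e3]
    linear_combination ((∏ x ∈ S.erase y, Real.sign (x - y)) * signMean P f (S.erase y)) * this
  have hconst : ∀ s ∈ Set.Ioo (-1) m, A s - B s = A t - B t := fun s hs =>
    isOpen_Ioo.is_const_of_deriv_eq_zero isPreconnected_Ioo
      (fun s hs => (hd s hs).differentiableAt.differentiableWithinAt)
      (fun s hs => (hd s hs).deriv) hs ⟨ht.1, htm⟩
  have hA : Tendsto A (𝓝[>] (-1)) (𝓝 0) := hf.tendsto_signMean_left hS
  have hB : Tendsto B (𝓝[>] (-1)) (𝓝 0) := by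
    have : Tendsto B (𝓝[>] (-1)) (𝓝 (∑ y ∈ S, 2 / Real.pi * 0 *
        ((∏ x ∈ S.erase y, Real.sign (x - y)) * signMean P f (S.erase y)))) :=
      tendsto_finsetSum _ fun y hy =>
        ((tendsto_arcsin_corr (hS y hy)).const_mul _).mul_const _
    simpa using this
  have hAB := hA.sub hB
  rw [sub_zero] at hAB
  have h0 : A t - B t = 0 := by
    refine tendsto_nhds_unique (tendsto_const_nhds.congr' ?_) hAB
    filter_upwards [Ioo_mem_nhdsGT (ht.1.trans htm)] with s hs using (hconst s hs).symm
  exact sub_eq_zero.1 h0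

end IsSzegoField

end

/-! ### The Gaussian power series as a Szegő field -/

section

open Filter Topology

variable {Ω : Type*} [MeasurableSpace Ω] {P : Measure Ω} {a : ℕ → Ω → ℝ}

/-- By Tonelli the integral is the first absolute moment of a standard Gaussian times a geometric
series. It gives both almost sure convergence and the integrable majorant. -/
lemma lintegral_tsum_enorm_ne_top (hlaw : ∀ k, HasLaw (a k) (gaussianReal 0 1) P) {r : ℝ}
    (h0 : 0 ≤ r) (h1 : r < 1) : ∫⁻ ω, ∑' k, ‖a k ω * r ^ k‖ₑ ∂P ≠ ⊤ := by
  rw [lintegral_tsum fun k => ((hlaw k).aemeasurable.mul_const _).enorm]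
  have e : ∀ k, ∫⁻ ω, ‖a k ω * r ^ k‖ₑ ∂P = (∫⁻ x, ‖x‖ₑ ∂(gaussianReal 0 1)) * ‖r‖ₑ ^ k := by
    intro k
    simp_rw [enorm_mul, enorm_pow]
    rw [lintegral_mul_const'' _ (hlaw k).aemeasurable.enorm, ← (hlaw k).map_eq,
      lintegral_map' measurable_enorm.aemeasurable (hlaw k).aemeasurable]
  simp_rw [e]
  rw [ENNReal.tsum_mul_left, ENNReal.tsum_geometric]
  refine ENNReal.mul_ne_top ?_ ?_
  · have hz : Integrable (fun z : ℝ => z) (gaussianReal 0 1) :=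
      (memLp_id_gaussianReal 1).integrable (by simp)
    exact hz.2.ne
  · rw [ENNReal.inv_ne_top, Real.enorm_of_nonneg h0]
    exact (tsub_pos_of_lt (by simpa using h1)).ne'

lemma norm_mul_pow_le {c s r : ℝ} (h : |s| ≤ r) (k : ℕ) : ‖c * s ^ k‖ ≤ ‖c * r ^ k‖ := by
  rw [norm_mul, norm_mul, norm_pow, norm_pow]
  exact mul_le_mul_of_nonneg_left (pow_le_pow_left₀ (norm_nonneg _)
    (h.trans (le_abs_self r)) k) (norm_nonneg _)

lemma ae_summable_mul_pow (hlaw : ∀ k, HasLaw (a k) (gaussianReal 0 1) P) :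
    ∀ᵐ ω ∂P, ∀ r : ℝ, 0 ≤ r → r < 1 → Summable fun k => a k ω * r ^ k := by
  -- Countably many radii increasing to one yield a single null set valid for all radii.
  have h : ∀ᵐ ω ∂P, ∀ n : ℕ, ∑' k, ‖a k ω * (1 - 1 / ((n : ℝ) + 1)) ^ k‖ₑ < ⊤ := by
    rw [ae_all_iff]
    intro n
    have hn : (0 : ℝ) < (n : ℝ) + 1 := by positivity
    refine ae_lt_top' (AEMeasurable.tsum fun k =>
      ((hlaw k).aemeasurable.mul_const _).enorm) (lintegral_tsum_enorm_ne_top hlaw ?_ ?_)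
    · rw [sub_nonneg, div_le_one hn]; linarith [n.cast_nonneg (α := ℝ)]
    · have : 0 < 1 / ((n : ℝ) + 1) := by positivity
      linarith
  filter_upwards [h] with ω hω r h0 h1
  obtain ⟨n, hn⟩ := exists_nat_one_div_lt (sub_pos.2 h1)
  have hs := tsum_enorm_ne_top_iff_summable_nnnorm.1 (hω n).ne
  refine Summable.of_norm_bounded (NNReal.summable_coe.2 hs) fun k => ?_
  exact norm_mul_pow_le (by rw [abs_of_nonneg h0]; linarith) k

lemma summable_mul_pow {c : ℕ → ℝ} (hc : ∀ r : ℝ, 0 ≤ r → r < 1 → Summable fun k => c k * r ^ k)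
    {t : ℝ} (ht : t ∈ Set.Ioo (-1 : ℝ) 1) : Summable fun k => c k * t ^ k :=
  Summable.of_norm_bounded (hc |t| (abs_nonneg t) (abs_lt.2 ht)).norm
    fun k => norm_mul_pow_le le_rfl k

/-- The characteristic function of a series of independent standard Gaussian variables. -/
lemma integral_exp_tsum_eq [IsProbabilityMeasure P] (hindep : iIndepFun a P)
    (hlaw : ∀ k, HasLaw (a k) (gaussianReal 0 1) P) (v : ℕ → ℝ) {Y : Ω → ℝ} {σ : ℝ}
    (hY : ∀ ω, HasSum (fun k => v k * a k ω) (Y ω)) (hσ : HasSum (fun k => v k ^ 2) σ) :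
    ∫ ω, Complex.exp ((Y ω : ℝ) * Complex.I) ∂P = Complex.exp (-(σ : ℝ) / 2) := by
  have hX : ∀ k, AEMeasurable (fun ω => v k * a k ω) P := fun k =>
    (hlaw k).aemeasurable.const_mul _
  have e : ∀ N, ∫ ω, Complex.exp ((∑ k ∈ Finset.range N, v k * a k ω : ℝ) * Complex.I) ∂P =
      Complex.exp (-(∑ k ∈ Finset.range N, v k ^ 2 : ℝ) / 2) := by
    intro N
    have hi : iIndepFun (fun k ω => v k * a k ω) P :=
      hindep.comp (fun k x => v k * x) fun k => measurable_const_mul _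
    have h1 := (hi.restrict (Finset.range N)).charFun_map_fun_finsetSum_eq_prod
      (fun k _ => hX k)
    have h2 := congrFun h1 1
    rw [charFun_apply_real, integral_map (Finset.aemeasurable_fun_sum _ fun k _ => hX k)
      (by fun_prop), Finset.prod_apply] at h2
    simp only [Complex.ofReal_one, one_mul] at h2
    rw [h2]
    rw [Finset.prod_congr rfl fun k _ => by
      rw [charFun_map_mul_comp (hlaw k).aemeasurable, (hlaw k).map_eq, charFun_gaussianReal]]
    rw [← Complex.exp_sum]
    congr 1
    push_cast
    rw [neg_div, Finset.sum_div, ← Finset.sum_neg_distrib]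
    refine Finset.sum_congr rfl fun k _ => ?_
    simp
  have l1 : Tendsto (fun N => ∫ ω, Complex.exp ((∑ k ∈ Finset.range N, v k * a k ω : ℝ) *
      Complex.I) ∂P) atTop (𝓝 (∫ ω, Complex.exp ((Y ω : ℝ) * Complex.I) ∂P)) := by
    refine tendsto_integral_of_dominated_convergence (fun _ => (1 : ℝ)) (fun N => ?_)
      (integrable_const _) (fun N => ae_of_all _ fun ω => ?_) (ae_of_all _ fun ω => ?_)
    · have := Finset.aemeasurable_fun_sum (Finset.range N) fun k _ => hX k
      exact (Complex.measurable_exp.comp_aemeasurable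
        ((Complex.measurable_ofReal.comp_aemeasurable this).mul_const _)).aestronglyMeasurable
    · rw [Complex.norm_exp_ofReal_mul_I]
    · have hc : Continuous fun x : ℝ => Complex.exp ((x : ℂ) * Complex.I) := by fun_prop
      exact (hc.tendsto _).comp (hY ω).tendsto_sum_nat
  have l2 : Tendsto (fun N => Complex.exp (-(∑ k ∈ Finset.range N, v k ^ 2 : ℝ) / 2)) atTop
      (𝓝 (Complex.exp (-(σ : ℝ) / 2))) := by
    have hc : Continuous fun x : ℝ => Complex.exp (-(x : ℂ) / 2) := by fun_prop
    exact (hc.tendsto _).comp hσ.tendsto_sum_nat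
  exact tendsto_nhds_unique (l1.congr e) l2

/-- A Gaussian power series with everywhere convergent paths is a Szegő field. -/
lemma isSzegoField_powerSeries [IsProbabilityMeasure P] (hindep : iIndepFun a P)
    (hlaw : ∀ k, HasLaw (a k) (gaussianReal 0 1) P) (hm : ∀ k, Measurable (a k))
    (hs : ∀ ω, ∀ r : ℝ, 0 ≤ r → r < 1 → Summable fun k => a k ω * r ^ k) :
    IsSzegoField P (fun t ω => powerSeries a ω t) where
  measurable t ht := by
    refine measurable_of_tendsto_metrizable (f := fun N ω => ∑ k ∈ Finset.range N, a k ω * t ^ k)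
      (fun N => Finset.measurable_fun_sum _ fun k _ => (hm k).mul_const _)
      (tendsto_pi_nhds.2 fun ω => ?_)
    exact (summable_mul_pow (hs ω) ht).hasSum.tendsto_sum_nat
  continuousAt ω t ht := by
    obtain ⟨r, hr, hr1⟩ : ∃ r, |t| < r ∧ r < 1 := exists_between (abs_lt.2 ht)
    have hc : ContinuousOn (fun s => ∑' k, a k ω * s ^ k) (Set.Icc (-r) r) :=
      continuousOn_tsum (fun k => by fun_prop)
        (hs ω r ((abs_nonneg t).trans hr.le) hr1).norm
        (fun k s hs => norm_mul_pow_le (abs_le.2 hs) k)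
    exact hc.continuousAt (Icc_mem_nhds (abs_lt.1 hr).1 (abs_lt.1 hr).2)
  exists_majorant r hr := by
    have hmeas : Measurable fun ω => ∑' k, ‖a k ω * r ^ k‖ₑ :=
      Measurable.tsum fun k => ((hm k).mul_const _).enorm
    refine ⟨fun ω => (∑' k, ‖a k ω * r ^ k‖ₑ).toReal, hmeas.ennreal_toReal,
      integrable_toReal_of_lintegral_ne_top hmeas.aemeasurable
        (lintegral_tsum_enorm_ne_top hlaw hr.1.le hr.2), fun ω s hsr => ?_⟩
    simp only [ENNReal.tsum_toReal_eq fun k => enorm_ne_top, toReal_enorm]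
    have hS := (hs ω r hr.1.le hr.2).norm
    exact tsum_of_norm_bounded hS.hasSum fun k => norm_mul_pow_le hsr k
  charFun_eq ι _ s ξ hsI := by
    refine integral_exp_tsum_eq hindep hlaw (fun k => ∑ i, ξ i * s i ^ k) (fun ω => ?_) ?_
    · have := hasSum_sum (s := Finset.univ) fun i _ =>
        (summable_mul_pow (hs ω) (hsI i)).hasSum.mul_left (ξ i)
      have e : (fun k => (∑ i, ξ i * s i ^ k) * a k ω) =
          fun k => ∑ i, ξ i * (a k ω * s i ^ k) := by
        funext k
        rw [Finset.sum_mul]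
        exact Finset.sum_congr rfl fun i _ => by ring
      rw [e]
      exact this
    · have : ∀ i j, HasSum (fun k => ξ i * ξ j * (s i * s j) ^ k)
          (ξ i * ξ j * covKernel (s i) (s j)) := by
        intro i j
        rw [covKernel, one_div]
        refine (hasSum_geometric_of_abs_lt_one ?_).mul_left _
        rw [abs_mul]
        exact mul_lt_one_of_nonneg_of_lt_one_left (abs_nonneg _) (abs_lt.2 (hsI i))
          (abs_lt.2 (hsI j)).le
      have h2 := hasSum_sum (s := Finset.univ) fun i _ =>
        hasSum_sum (s := Finset.univ) fun j _ => this i j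
      convert h2 using 2 with k
      rw [sq, Finset.sum_mul_sum]
      refine Finset.sum_congr rfl fun i _ => Finset.sum_congr rfl fun j _ => ?_
      rw [mul_pow]
      ring

/-- A sequence of independent standard Gaussian variables has a version for which the power series
converges everywhere. -/
lemma exists_version [IsProbabilityMeasure P] (hindep : iIndepFun a P)
    (hlaw : ∀ k, HasLaw (a k) (gaussianReal 0 1) P) :
    ∃ b : ℕ → Ω → ℝ, (∀ᵐ ω ∂P, ∀ k, a k ω = b k ω) ∧
      IsSzegoField P (fun t ω => powerSeries b ω t) := by
  have hae : ∀ᵐ ω ∂P, (∀ k, a k ω = (hlaw k).aemeasurable.mk (a k) ω) ∧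
      ∀ r : ℝ, 0 ≤ r → r < 1 → Summable fun k => a k ω * r ^ k :=
    (ae_all_iff.2 fun k => (hlaw k).aemeasurable.ae_eq_mk).and (ae_summable_mul_pow hlaw)
  obtain ⟨N, hN, hNm, hN0⟩ := exists_measurable_superset_of_null (ae_iff.1 hae)
  have hA : ∀ ω ∉ N, (∀ k, a k ω = (hlaw k).aemeasurable.mk (a k) ω) ∧
      ∀ r : ℝ, 0 ≤ r → r < 1 → Summable fun k => a k ω * r ^ k := fun ω hω =>
    by_contra fun h => hω (hN h)
  -- On the null set all coefficients are set to zero, so convergence and measurability hold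
  -- everywhere without changing the joint law.
  let b : ℕ → Ω → ℝ := fun k => Nᶜ.indicator ((hlaw k).aemeasurable.mk (a k))
  have hab : ∀ᵐ ω ∂P, ∀ k, a k ω = b k ω := by
    filter_upwards [measure_eq_zero_iff_ae_notMem.1 hN0] with ω hω k
    simp only [b]
    rw [Set.indicator_of_mem (show ω ∈ Nᶜ from hω), (hA ω hω).1 k]
  have hab' : ∀ k, a k =ᵐ[P] b k := fun k => hab.mono fun ω h => h k
  have hbm : ∀ k, Measurable (b k) := fun k =>
    (hlaw k).aemeasurable.measurable_mk.indicator hNm.compl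
  refine ⟨b, hab, isSzegoField_powerSeries (hindep.congr hab') (fun k => ?_) hbm fun ω r h0 h1 => ?_⟩
  · exact ⟨(hbm k).aemeasurable, (Measure.map_congr (hab' k)).symm.trans (hlaw k).map_eq⟩
  · by_cases hω : ω ∈ N
    · have : ∀ k, b k ω = 0 := fun k => Set.indicator_of_notMem (fun h : ω ∈ Nᶜ => h hω) _
      simp only [this, zero_mul]
      exact summable_zero
    · refine ((hA ω hω).2 r h0 h1).congr fun k => ?_
      rw [(hA ω hω).1 k]
      simp only [b]
      rw [Set.indicator_of_mem (show ω ∈ Nᶜ from hω)]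

end

/-! ### Pfaffians: first-row expansion and permutation of indices -/

section

open Equiv

/-- The permutation of `Fin (m + 2)` with values `0`, `i + 1`, followed by the remaining elements
in the order prescribed by `η`. -/
def consPairPerm {m : ℕ} (i : Fin (m + 1)) (η : Perm (Fin m)) : Perm (Fin (m + 2)) :=
  Perm.decomposeFin.symm (0, (Fin.cycleRange i).symm * Perm.decomposeFin.symm (0, η))

section consPairPerm

variable {m : ℕ} (i : Fin (m + 1)) (η : Perm (Fin m))

lemma consPairPerm_zero : consPairPerm i η 0 = 0 := by simp [consPairPerm]

lemma consPairPerm_one : consPairPerm i η 1 = i.succ := by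
  rw [← Fin.succ_zero_eq_one, consPairPerm, Perm.decomposeFin_symm_apply_succ]
  simp

lemma consPairPerm_succ_succ (k : Fin m) :
    consPairPerm i η k.succ.succ = (i.succAbove (η k)).succ := by
  rw [consPairPerm, Perm.decomposeFin_symm_apply_succ]
  simp

/-- The cycle moving `0` to `i` has length `i + 1` and contributes `(-1) ^ i`; extending a
permutation by a fixed point leaves its sign unchanged. -/
lemma sign_consPairPerm :
    Perm.sign (consPairPerm i η) = (-1) ^ (i : ℕ) * Perm.sign η := by
  simp [consPairPerm, Perm.sign_mul, Perm.sign_symm, Fin.sign_cycleRange]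

lemma consPairPerm_injective :
    Function.Injective fun p : Fin (m + 1) × Perm (Fin m) => consPairPerm p.1 p.2 := by
  rintro ⟨i, η⟩ ⟨j, θ⟩ h
  simp only at h
  have h1 : i = j := by
    have := congrArg (fun e => e 1) h
    simpa only [consPairPerm_one, Fin.succ_inj] using this
  subst h1
  refine Prod.ext rfl (Equiv.ext fun k => ?_)
  have := congrArg (fun e => e k.succ.succ) h
  simpa only [consPairPerm_succ_succ, Fin.succ_inj, Fin.succAbove_right_inj] using this

lemma exists_perm_of_apply_zero {k : ℕ} {η : Perm (Fin (k + 1))} (h : η 0 = 0) :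
    ∃ θ, η = Perm.decomposeFin.symm (0, θ) := by
  obtain ⟨⟨p, θ⟩, rfl⟩ := Perm.decomposeFin.symm.surjective η
  rw [Perm.decomposeFin_symm_apply_zero] at h
  exact ⟨θ, by rw [h]⟩

/-- Strip off the fixed point `0`, undo the cycle that carries `0` to its image under what remains,
and strip off the new fixed point. -/
lemma exists_consPairPerm {η : Perm (Fin (m + 2))} (h : η 0 = 0) :
    ∃ p : Fin (m + 1) × Perm (Fin m), consPairPerm p.1 p.2 = η := by
  obtain ⟨θ, rfl⟩ := exists_perm_of_apply_zero h
  have h0 : (Fin.cycleRange (θ 0) * θ) 0 = 0 := by simp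
  obtain ⟨ζ, hζ⟩ := exists_perm_of_apply_zero h0
  refine ⟨(θ 0, ζ), ?_⟩
  simp only [consPairPerm]
  rw [← hζ]
  congr 2
  ext k
  simp

lemma sum_apply_zero_eq_zero (F : Perm (Fin (m + 2)) → ℝ) :
    ∑ η with η 0 = 0, F η = ∑ i, ∑ η, F (consPairPerm i η) := by
  classical
  rw [← Finset.sum_product' (f := fun i η => F (consPairPerm i η))]
  symm
  refine Finset.sum_bij (fun p _ => consPairPerm p.1 p.2) (fun p _ => ?_)
    (fun p _ q _ h => consPairPerm_injective h) (fun η hη => ?_) (fun p _ => rfl)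
  · simp [consPairPerm_zero]
  · obtain ⟨p, hp⟩ := exists_consPairPerm (Finset.mem_filter.1 hη).2
    exact ⟨p, by simp, hp⟩

end consPairPerm

/-- The signed product attached to a permutation in the definition of the Pfaffian. -/
def pfaffianTerm {n : ℕ} (B : Matrix (Fin (2 * n)) (Fin (2 * n)) ℝ) (η : Perm (Fin (2 * n))) : ℝ :=
  ((Perm.sign η : ℤ) : ℝ) * ∏ i : Fin n, B (η (fstIdx i)) (η (sndIdx i))

/-- The condition selecting one permutation for every perfect matching. -/
def IsMatchingPerm {n : ℕ} (η : Perm (Fin (2 * n))) : Prop :=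
  (∀ i : Fin n, η (fstIdx i) < η (sndIdx i)) ∧ StrictMono (fun i : Fin n => η (fstIdx i))

open Classical in
lemma pfaffian_eq_sum_pfaffianTerm {n : ℕ} (B : Matrix (Fin (2 * n)) (Fin (2 * n)) ℝ) :
    pfaffian B = ∑ η with IsMatchingPerm η, pfaffianTerm B η := by
  unfold pfaffian
  refine Finset.sum_congr ?_ fun _ _ => rfl
  ext η
  simp only [Finset.mem_filter, Finset.mem_univ, true_and]
  rfl

/-- The minor obtained by deleting the rows and columns `0` and `i + 1`. -/
def dropPair {m : ℕ} (B : Matrix (Fin (m + 2)) (Fin (m + 2)) ℝ) (i : Fin (m + 1)) :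
    Matrix (Fin m) (Fin m) ℝ :=
  B.submatrix (fun k => (i.succAbove k).succ) (fun k => (i.succAbove k).succ)

lemma fstIdx_zero {n : ℕ} : fstIdx (0 : Fin (n + 1)) = (0 : Fin (2 * n + 2)) := rfl

lemma sndIdx_zero {n : ℕ} : sndIdx (0 : Fin (n + 1)) = (1 : Fin (2 * n + 2)) := by
  apply Fin.ext
  simp [sndIdx]

lemma fstIdx_succ {n : ℕ} (i : Fin n) :
    fstIdx i.succ = ((fstIdx i).succ.succ : Fin (2 * n + 2)) := by
  apply Fin.ext
  simp only [fstIdx, Fin.val_succ]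
  ring

lemma sndIdx_succ {n : ℕ} (i : Fin n) :
    sndIdx i.succ = ((sndIdx i).succ.succ : Fin (2 * n + 2)) := by
  apply Fin.ext
  simp only [sndIdx, Fin.val_succ]
  ring

lemma pfaffianTerm_consPairPerm {n : ℕ} (B : Matrix (Fin (2 * n + 2)) (Fin (2 * n + 2)) ℝ)
    (i : Fin (2 * n + 1)) (η : Perm (Fin (2 * n))) :
    pfaffianTerm (n := n + 1) B (consPairPerm i η) =
      (-1) ^ (i : ℕ) * B 0 i.succ * pfaffianTerm (dropPair B i) η := by
  unfold pfaffianTerm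
  rw [Fin.prod_univ_succ]
  simp only [fstIdx_succ, sndIdx_succ, fstIdx_zero, sndIdx_zero]
  have h0 : (consPairPerm i η : Perm (Fin (2 * n + 2))) 0 = 0 := consPairPerm_zero i η
  have h1 : (consPairPerm i η : Perm (Fin (2 * n + 2))) 1 = i.succ := consPairPerm_one i η
  have hs : Perm.sign (consPairPerm i η : Perm (Fin (2 * n + 2))) =
    (-1) ^ (i : ℕ) * Perm.sign η := sign_consPairPerm i η
  -- The index types `Fin (2 * (n + 1))` and `Fin (2 * n + 2)` agree by definition but not
  -- syntactically.
  erw [h0, h1, hs]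
  have hp : ∏ x : Fin n, B (consPairPerm i η (fstIdx x).succ.succ)
      (consPairPerm i η (sndIdx x).succ.succ) =
      ∏ x : Fin n, dropPair B i (η (fstIdx x)) (η (sndIdx x)) :=
    Finset.prod_congr rfl fun x _ => by
      rw [consPairPerm_succ_succ, consPairPerm_succ_succ]; rfl
  erw [hp]
  push_cast
  ring

lemma isMatchingPerm_consPairPerm {n : ℕ} (i : Fin (2 * n + 1)) (η : Perm (Fin (2 * n))) :
    IsMatchingPerm (n := n + 1) (consPairPerm i η) ↔ IsMatchingPerm η := by
  have f0 : consPairPerm i η (fstIdx (0 : Fin (n + 1))) = 0 := consPairPerm_zero i η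
  have s0 : consPairPerm i η (sndIdx (0 : Fin (n + 1))) = i.succ := by
    rw [sndIdx_zero]; exact consPairPerm_one i η
  have fs : ∀ x : Fin n, consPairPerm i η (fstIdx x.succ) = (i.succAbove (η (fstIdx x))).succ :=
    fun x => by rw [fstIdx_succ]; exact consPairPerm_succ_succ i η _
  have ss : ∀ x : Fin n, consPairPerm i η (sndIdx x.succ) = (i.succAbove (η (sndIdx x))).succ :=
    fun x => by rw [sndIdx_succ]; exact consPairPerm_succ_succ i η _
  have hlt : ∀ a b : Fin (2 * n), (i.succAbove a).succ < (i.succAbove b).succ ↔ a < b :=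
    fun a b => Fin.succ_lt_succ_iff.trans Fin.succAbove_lt_succAbove_iff
  constructor
  · rintro ⟨h1, h2⟩
    refine ⟨fun x => ?_, fun x y hxy => ?_⟩
    · have h : consPairPerm i η (fstIdx x.succ) < consPairPerm i η (sndIdx x.succ) := h1 x.succ
      rw [fs, ss] at h
      exact (hlt _ _).1 h
    · have h : consPairPerm i η (fstIdx x.succ) < consPairPerm i η (fstIdx y.succ) :=
        h2 (Fin.succ_lt_succ_iff.2 hxy)
      rw [fs, fs] at h
      exact (hlt _ _).1 h
  · rintro ⟨h1, h2⟩
    refine ⟨fun x => ?_, fun x y hxy => ?_⟩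
    · change consPairPerm i η (fstIdx x) < consPairPerm i η (sndIdx x)
      cases x using Fin.cases with
      | zero => rw [f0, s0]; exact Fin.succ_pos i
      | succ x => rw [fs, ss]; exact (hlt _ _).2 (h1 x)
    · change consPairPerm i η (fstIdx x) < consPairPerm i η (fstIdx y)
      cases y using Fin.cases with
      | zero => exact absurd hxy (Fin.not_lt_zero x)
      | succ y =>
        cases x using Fin.cases with
        | zero => rw [f0, fs]; exact Fin.succ_pos _
        | succ x => rw [fs, fs]; exact (hlt _ _).2 (h2 (Fin.succ_lt_succ_iff.1 hxy))

lemma exists_eq_fstIdx_or_sndIdx {n : ℕ} (k : Fin (2 * n)) :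
    ∃ j : Fin n, k = fstIdx j ∨ k = sndIdx j := by
  refine ⟨⟨(k : ℕ) / 2, by omega⟩, ?_⟩
  rcases Nat.even_or_odd' (k : ℕ) with ⟨c, hc | hc⟩
  · exact Or.inl (Fin.ext (by simp only [fstIdx]; omega))
  · exact Or.inr (Fin.ext (by simp only [sndIdx]; omega))

/-- The value `0` cannot be the larger element of its pair, and among smaller elements it must come
first. -/
lemma IsMatchingPerm.apply_zero {n : ℕ} {η : Perm (Fin (2 * n + 2))}
    (h : IsMatchingPerm (n := n + 1) η) : η 0 = 0 := by
  obtain ⟨h1, h2⟩ := h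
  obtain ⟨j, hj⟩ := exists_eq_fstIdx_or_sndIdx (n := n + 1) (η.symm 0)
  have hz : ∀ x : Fin (2 * n + 2), ¬ x < 0 := fun x => Fin.not_lt_zero x
  rcases hj with hj | hj
  · have hj' : η (fstIdx j) = 0 := by rw [← hj]; exact η.apply_symm_apply 0
    rcases Fin.eq_zero_or_eq_succ j with rfl | ⟨i, rfl⟩
    · exact hj'
    · have := h2 (Fin.succ_pos i)
      simp only [hj'] at this
      exact absurd this (hz _)
  · have hj' : η (sndIdx j) = 0 := by rw [← hj]; exact η.apply_symm_apply 0
    have := h1 j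
    rw [hj'] at this
    exact absurd this (hz _)

/-- Expansion of the Pfaffian along the first row. -/
lemma pfaffian_succ {n : ℕ} (B : Matrix (Fin (2 * n + 2)) (Fin (2 * n + 2)) ℝ) :
    pfaffian (n := n + 1) B =
      ∑ i : Fin (2 * n + 1), (-1) ^ (i : ℕ) * B 0 i.succ * pfaffian (dropPair B i) := by
  classical
  have h : pfaffian (n := n + 1) B = ∑ η : Perm (Fin (2 * n + 2)) with η 0 = 0,
      if IsMatchingPerm (n := n + 1) η then pfaffianTerm (n := n + 1) B η else 0 := by
    rw [pfaffian_eq_sum_pfaffianTerm, ← Finset.sum_filter, Finset.filter_filter]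
    refine Finset.sum_congr (Finset.filter_congr fun η _ => ?_) fun _ _ => rfl
    exact ⟨fun h => ⟨h.apply_zero, h⟩, fun h => h.2⟩
  rw [h, sum_apply_zero_eq_zero]
  refine Finset.sum_congr rfl fun i _ => ?_
  simp only [isMatchingPerm_consPairPerm, pfaffianTerm_consPairPerm]
  rw [← Finset.sum_filter, ← Finset.mul_sum, pfaffian_eq_sum_pfaffianTerm]

/-- The sum of the Pfaffian terms over all permutations. -/
def fullPfaffianSum {n : ℕ} (B : Matrix (Fin (2 * n)) (Fin (2 * n)) ℝ) : ℝ :=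
  ∑ η : Perm (Fin (2 * n)), pfaffianTerm B η

lemma fstIdx_injective {n : ℕ} : Function.Injective (fstIdx (n := n)) := fun i j h => by
  have := congrArg Fin.val h
  simp only [fstIdx] at this
  exact Fin.ext (by omega)

lemma sndIdx_injective {n : ℕ} : Function.Injective (sndIdx (n := n)) := fun i j h => by
  have := congrArg Fin.val h
  simp only [sndIdx] at this
  exact Fin.ext (by omega)

lemma fstIdx_ne_sndIdx {n : ℕ} (i j : Fin n) : fstIdx i ≠ sndIdx j := fun h => by
  have := congrArg Fin.val h
  simp only [fstIdx, sndIdx] at this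
  omega

/-- Exchanging two whole pairs is an even permutation and merely reorders the factors. -/
lemma pfaffianTerm_mul_swap_swap {n : ℕ} (B : Matrix (Fin (2 * n)) (Fin (2 * n)) ℝ)
    (η : Perm (Fin (2 * n))) (i j : Fin n) :
    pfaffianTerm B (η * (swap (fstIdx i) (fstIdx j) * swap (sndIdx i) (sndIdx j))) =
      pfaffianTerm B η := by
  unfold pfaffianTerm
  have hs : Perm.sign (swap (fstIdx i) (fstIdx j) * swap (sndIdx i) (sndIdx j)) = 1 := by
    rcases eq_or_ne i j with rfl | h
    · simp
    · rw [Perm.sign_mul, Perm.sign_swap (fstIdx_injective.ne h),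
        Perm.sign_swap (sndIdx_injective.ne h)]
      rfl
  rw [Perm.sign_mul, hs, mul_one]
  congr 1
  rw [← Equiv.prod_comp (swap i j)]
  refine Finset.prod_congr rfl fun l _ => ?_
  have h1 : ∀ l, swap (fstIdx i) (fstIdx j) (sndIdx l) = sndIdx l := fun l =>
    swap_apply_of_ne_of_ne (fstIdx_ne_sndIdx _ _).symm (fstIdx_ne_sndIdx _ _).symm
  have h2 : ∀ l, swap (sndIdx i) (sndIdx j) (fstIdx l) = fstIdx l := fun l =>
    swap_apply_of_ne_of_ne (fstIdx_ne_sndIdx _ _) (fstIdx_ne_sndIdx _ _)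
  simp only [Perm.mul_apply]
  rw [h2, ← sndIdx_injective.map_swap, h1, ← fstIdx_injective.map_swap]
  simp

/-- Reversing one pair is odd, and skew-symmetry makes exactly one factor change sign. -/
lemma pfaffianTerm_mul_swap {n : ℕ} {B : Matrix (Fin (2 * n)) (Fin (2 * n)) ℝ}
    (hB : ∀ i j, B j i = -B i j) (η : Perm (Fin (2 * n))) (i : Fin n) :
    pfaffianTerm B (η * swap (fstIdx i) (sndIdx i)) = pfaffianTerm B η := by
  classical
  unfold pfaffianTerm
  rw [Perm.sign_mul, Perm.sign_swap (fstIdx_ne_sndIdx i i)]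
  have : ∏ l : Fin n, B ((η * swap (fstIdx i) (sndIdx i)) (fstIdx l))
      ((η * swap (fstIdx i) (sndIdx i)) (sndIdx l)) =
      ∏ l : Fin n, (if l = i then -1 else 1) * B (η (fstIdx l)) (η (sndIdx l)) := by
    refine Finset.prod_congr rfl fun l _ => ?_
    rcases eq_or_ne l i with rfl | h
    · simp [hB (η (fstIdx l))]
    · rw [if_neg h, one_mul, Perm.mul_apply, Perm.mul_apply,
        swap_apply_of_ne_of_ne (fstIdx_injective.ne h) (fstIdx_ne_sndIdx _ _),
        swap_apply_of_ne_of_ne (fstIdx_ne_sndIdx _ _).symm (sndIdx_injective.ne h)]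
  rw [this, Finset.prod_mul_distrib, Finset.prod_ite_eq']
  simp

/-- Exchange pair `0` with the pair containing `k`, first reversing pair `0` if `k` is a second
element. Hence the position of the value `0` is irrelevant to the full sum. -/
lemma exists_pfaffianTerm_mul_eq {n : ℕ} {B : Matrix (Fin (2 * n + 2)) (Fin (2 * n + 2)) ℝ}
    (hB : ∀ i j, B j i = -B i j) (k : Fin (2 * n + 2)) :
    ∃ τ : Perm (Fin (2 * n + 2)), τ 0 = k ∧ ∀ η : Perm (Fin (2 * n + 2)),
      pfaffianTerm (n := n + 1) B (η * τ) = pfaffianTerm (n := n + 1) B η := by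
  obtain ⟨j, hj⟩ := exists_eq_fstIdx_or_sndIdx (n := n + 1) k
  have hB' : ∀ i j : Fin (2 * (n + 1)), B j i = -B i j := hB
  have e1 : swap (sndIdx (0 : Fin (n + 1))) (sndIdx j) (fstIdx (0 : Fin (n + 1))) =
      fstIdx (0 : Fin (n + 1)) :=
    swap_apply_of_ne_of_ne (fstIdx_ne_sndIdx _ _) (fstIdx_ne_sndIdx _ _)
  have e2 : swap (fstIdx (0 : Fin (n + 1))) (fstIdx j) (sndIdx j) = sndIdx j :=
    swap_apply_of_ne_of_ne (fstIdx_ne_sndIdx _ _).symm (fstIdx_ne_sndIdx _ _).symm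
  rcases hj with rfl | rfl
  · refine ⟨swap (fstIdx 0) (fstIdx j) * swap (sndIdx 0) (sndIdx j), ?_,
      fun η => pfaffianTerm_mul_swap_swap (n := n + 1) B η 0 j⟩
    change swap (fstIdx (0 : Fin (n + 1))) (fstIdx j)
      (swap (sndIdx (0 : Fin (n + 1))) (sndIdx j) (fstIdx (0 : Fin (n + 1)))) = fstIdx j
    rw [e1, swap_apply_left]
  · refine ⟨swap (fstIdx 0) (fstIdx j) * swap (sndIdx 0) (sndIdx j) *
      swap (fstIdx 0) (sndIdx 0), ?_, fun η => ?_⟩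
    · change swap (fstIdx (0 : Fin (n + 1))) (fstIdx j)
        (swap (sndIdx (0 : Fin (n + 1))) (sndIdx j)
          (swap (fstIdx (0 : Fin (n + 1))) (sndIdx (0 : Fin (n + 1)))
            (fstIdx (0 : Fin (n + 1))))) = sndIdx j
      rw [swap_apply_left, swap_apply_left, e2]
    · rw [← mul_assoc]
      exact (pfaffianTerm_mul_swap hB' _ 0).trans
        (pfaffianTerm_mul_swap_swap (n := n + 1) B η 0 j)

lemma fullPfaffianSum_succ {n : ℕ} {B : Matrix (Fin (2 * n + 2)) (Fin (2 * n + 2)) ℝ}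
    (hB : ∀ i j, B j i = -B i j) :
    fullPfaffianSum (n := n + 1) B = (2 * (n + 1)) *
      ∑ i : Fin (2 * n + 1), (-1) ^ (i : ℕ) * B 0 i.succ * fullPfaffianSum (dropPair B i) := by
  classical
  have h0 : ∑ η : Perm (Fin (2 * n + 2)) with η 0 = 0, pfaffianTerm (n := n + 1) B η =
      ∑ i : Fin (2 * n + 1), (-1) ^ (i : ℕ) * B 0 i.succ * fullPfaffianSum (dropPair B i) := by
    rw [sum_apply_zero_eq_zero]
    simp only [pfaffianTerm_consPairPerm, fullPfaffianSum, Finset.mul_sum]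
  -- All `2n + 2` fibres over the position of `0` have equal sums, because right multiplication by
  -- `τ` moves that position from `k` to `0`.
  have hk : ∀ k : Fin (2 * n + 2),
      ∑ η : Perm (Fin (2 * n + 2)) with η.symm 0 = k, pfaffianTerm (n := n + 1) B η =
      ∑ η : Perm (Fin (2 * n + 2)) with η 0 = 0, pfaffianTerm (n := n + 1) B η := by
    intro k
    obtain ⟨τ, hτ, hτB⟩ := exists_pfaffianTerm_mul_eq hB k
    refine Finset.sum_bij (fun η _ => η * τ) (fun η hη => ?_)
      (fun η _ θ _ h => mul_right_cancel h) (fun θ hθ => ⟨θ * τ⁻¹, ?_, by simp⟩)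
      (fun η _ => (hτB η).symm)
    · simp only [Finset.mem_filter, Finset.mem_univ, true_and, symm_apply_eq] at hη ⊢
      rw [Perm.mul_apply, hτ, hη]
    · simp only [Finset.mem_filter, Finset.mem_univ, true_and, symm_apply_eq] at hθ ⊢
      rw [Perm.mul_apply, ← hτ]
      simp [hθ]
  have : fullPfaffianSum (n := n + 1) B = ∑ k : Fin (2 * n + 2),
      ∑ η : Perm (Fin (2 * n + 2)) with η.symm 0 = k, pfaffianTerm (n := n + 1) B η :=
    (Finset.sum_fiberwise _ (fun η : Perm (Fin (2 * n + 2)) => η.symm 0) _).symm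
  rw [this, Finset.sum_congr rfl fun k _ => hk k, h0]
  simp only [Finset.sum_const, Finset.card_univ, Fintype.card_fin, nsmul_eq_mul]
  push_cast
  ring

/-- Each perfect matching is counted once per ordering of its pairs and orientation of each pair.
The full sum is useful because it can be reindexed by left multiplication, which does not preserve
the normalised permutations. -/
lemma fullPfaffianSum_eq {n : ℕ} {B : Matrix (Fin (2 * n)) (Fin (2 * n)) ℝ}
    (hB : ∀ i j, B j i = -B i j) :
    fullPfaffianSum B = 2 ^ n * (n.factorial : ℝ) * pfaffian B := by
  induction n with
  | zero =>
    have hu : ∀ η : Perm (Fin (2 * 0)), IsMatchingPerm η := fun η =>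
      ⟨fun i => i.elim0, fun i => i.elim0⟩
    rw [pfaffian_eq_sum_pfaffianTerm, fullPfaffianSum]
    simp [hu]
  | succ n ih =>
    have h1 := fullPfaffianSum_succ (n := n) (B := B) hB
    have h2 := pfaffian_succ (n := n) B
    rw [h1, h2, Finset.mul_sum, Finset.mul_sum]
    refine Finset.sum_congr rfl fun i _ => ?_
    rw [ih (B := dropPair B i) fun k l => hB _ _, Nat.factorial_succ]
    push_cast
    ring

/-- The behaviour of the Pfaffian under simultaneous permutation of rows and columns. -/
lemma pfaffian_submatrix_perm {n : ℕ} {B : Matrix (Fin (2 * n)) (Fin (2 * n)) ℝ}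
    (hB : ∀ i j, B j i = -B i j) (σ : Perm (Fin (2 * n))) :
    pfaffian (B.submatrix σ σ) = ((Perm.sign σ : ℤ) : ℝ) * pfaffian B := by
  have h1 := fullPfaffianSum_eq (B := B.submatrix σ σ) fun i j => hB _ _
  have h2 := fullPfaffianSum_eq hB
  have h3 : fullPfaffianSum (B.submatrix σ σ) = ((Perm.sign σ : ℤ) : ℝ) * fullPfaffianSum B := by
    unfold fullPfaffianSum
    rw [← Equiv.sum_comp (Equiv.mulLeft σ) (pfaffianTerm B), Finset.mul_sum]
    refine Finset.sum_congr rfl fun η _ => ?_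
    have hσ : ((Perm.sign σ : ℤ) : ℝ) * ((Perm.sign σ : ℤ) : ℝ) = 1 := by
      rw [← Int.cast_mul, ← Units.val_mul, Int.units_mul_self]; simp
    simp only [pfaffianTerm, Equiv.coe_mulLeft, Perm.sign_mul, Matrix.submatrix_apply,
      Perm.mul_apply, Units.val_mul, Int.cast_mul]
    rw [← mul_assoc, ← mul_assoc, hσ, one_mul]
  have h4 : (2 ^ n * (n.factorial : ℝ)) ≠ 0 := by positivity
  refine mul_left_cancel₀ h4 ?_
  rw [← h1, h3, h2]
  ring

lemma pfaffian_smul {n : ℕ} (c : ℝ) (B : Matrix (Fin (2 * n)) (Fin (2 * n)) ℝ) :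
    pfaffian (c • B) = c ^ n * pfaffian B := by
  unfold pfaffian
  rw [Finset.mul_sum]
  refine Finset.sum_congr rfl fun η _ => ?_
  simp only [Matrix.smul_apply, smul_eq_mul, Finset.prod_mul_distrib, Finset.prod_const,
    Finset.card_univ, Fintype.card_fin]
  ring

lemma pfaffian_of_isEmpty (B : Matrix (Fin (2 * 0)) (Fin (2 * 0)) ℝ) : pfaffian B = 1 := by
  have hu : ∀ η : Perm (Fin (2 * 0)), IsMatchingPerm η := fun η =>
    ⟨fun i => i.elim0, fun i => i.elim0⟩
  rw [pfaffian_eq_sum_pfaffianTerm]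
  simp only [hu, Finset.filter_true, pfaffianTerm]
  have : Subsingleton (Perm (Fin (2 * 0))) := inferInstanceAs (Subsingleton (Perm (Fin 0)))
  rw [Fintype.sum_subsingleton _ (1 : Perm (Fin (2 * 0)))]
  simp

end

/-! ### Sign products and the Pfaffian formula for sign means -/

lemma sign_prod_real {ι : Type*} (S : Finset ι) (g : ι → ℝ) :
    Real.sign (∏ i ∈ S, g i) = ∏ i ∈ S, Real.sign (g i) :=
  map_prod (⟨⟨Real.sign, Real.sign_one⟩, sign_mul_real⟩ : ℝ →* ℝ) g S

lemma prod_prod_sign_of_strictMono {m : ℕ} {t : Fin m → ℝ} (ht : StrictMono t) :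
    ∏ i, ∏ j ∈ Finset.Ioi i, Real.sign (t j - t i) = 1 :=
  Finset.prod_eq_one fun _ _ => Finset.prod_eq_one fun _ hj =>
    Real.sign_of_pos (sub_pos.2 (ht (Finset.mem_Ioi.1 hj)))

lemma prod_prod_sign_eq_sign_vandermonde {m : ℕ} (t : Fin m → ℝ) :
    ∏ i, ∏ j ∈ Finset.Ioi i, Real.sign (t j - t i) = Real.sign (Matrix.vandermonde t).det := by
  rw [Matrix.det_vandermonde, sign_prod_real]
  simp only [sign_prod_real]

/-- The product is the sign of a Vandermonde determinant, which is positive for sorted points and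
alternates under permutation of its rows. -/
lemma prod_prod_sign_eq_sign_perm {m : ℕ} {t : Fin m → ℝ} {σ : Equiv.Perm (Fin m)}
    (ht : StrictMono (t ∘ σ)) :
    ∏ i, ∏ j ∈ Finset.Ioi i, Real.sign (t j - t i) = ((Equiv.Perm.sign σ : ℤ) : ℝ) := by
  have h1 := prod_prod_sign_of_strictMono ht
  rw [prod_prod_sign_eq_sign_vandermonde] at h1 ⊢
  have h2 : (Matrix.vandermonde (t ∘ σ)).det =
      ((Equiv.Perm.sign σ : ℤ) : ℝ) * (Matrix.vandermonde t).det :=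
    Matrix.det_permute σ (Matrix.vandermonde t)
  rw [h2, sign_mul_real] at h1
  rcases Int.units_eq_one_or (Equiv.Perm.sign σ) with h | h
  · simpa [h] using h1
  · rw [h] at h1 ⊢
    simp [Real.sign_neg] at h1 ⊢
    linarith

lemma K22_of_lt {s t : ℝ} (h : s < t) : K22 s t = Real.arcsin (corr s t) := by
  rw [K22, Real.sign_of_pos (sub_pos.2 h), one_mul]

lemma K22_skew (s t : ℝ) : K22 t s = -K22 s t := by
  rw [K22, K22, ← neg_sub t s, Real.sign_neg, corr_comm t s, neg_mul]

lemma K22_self (t : ℝ) : K22 t t = 0 := by simp [K22]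

lemma skewOfUpper_eq {m : ℕ} {t : Fin m → ℝ} (ht : StrictMono t) {A : Fin m → Fin m → ℝ} {c : ℝ}
    (hA : ∀ i j, i < j → A i j = c * Real.arcsin (corr (t i) (t j))) :
    skewOfUpper A = c • Matrix.of fun i j => K22 (t i) (t j) := by
  ext i j
  simp only [skewOfUpper, Matrix.of_apply, Matrix.smul_apply, smul_eq_mul]
  rcases lt_trichotomy i j with h | rfl | h
  · rw [if_pos h, hA _ _ h, K22_of_lt (ht h)]
  · simp [K22_self]
  · rw [if_neg h.not_gt, if_pos h, hA _ _ h, K22_skew, K22_of_lt (ht h), mul_neg]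

lemma prod_sign_succAbove {m : ℕ} {s : Fin (m + 1) → ℝ} (hs : StrictMono s) (i : Fin (m + 1)) :
    ∏ k, Real.sign (s (i.succAbove k) - s i) = (-1) ^ (i : ℕ) := by
  have h : ∀ k : Fin m, Real.sign (s (i.succAbove k) - s i) =
      if k.castSucc < i then -1 else 1 := by
    intro k
    split_ifs with hk
    · exact Real.sign_of_neg (sub_neg.2 (hs (Fin.succAbove_lt_iff_castSucc_lt i k |>.2 hk)))
    · exact Real.sign_of_pos (sub_pos.2 (hs (Fin.lt_succAbove_iff_le_castSucc i k |>.2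
        (not_lt.1 hk))))
  simp only [h]
  rw [Finset.prod_ite, Finset.prod_const, Finset.prod_const_one, mul_one]
  congr 1
  simp only [Fin.lt_def, Fin.val_castSucc]
  rw [Fin.card_filter_val_lt]
  omega

namespace IsSzegoField

variable {Ω : Type*} [MeasurableSpace Ω] {P : Measure Ω} [IsProbabilityMeasure P] {f : ℝ → Ω → ℝ}

lemma signMean_pair (hf : IsSzegoField P f) {s t : ℝ} (hs : s ∈ Set.Ioo (-1 : ℝ) 1)
    (ht : t ∈ Set.Ioo (-1 : ℝ) 1) (h : s < t) :
    ∫ ω, Real.sign (f s ω) * Real.sign (f t ω) ∂P =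
      2 / Real.pi * Real.arcsin (corr s t) := by
  have := hf.signMean_expansion hs (S := {t}) (by simpa using ht) (by simpa using h)
  simpa [signMean] using this

/-- The probabilistic expansion along the leftmost point and the first-row expansion of the Pfaffian
are the same recursion: `prod_sign_succAbove` supplies the alternating sign, and the remaining
points are again increasing. -/
lemma signMean_of_strictMono (hf : IsSzegoField P f) {n : ℕ} {t : Fin (2 * n) → ℝ}
    (hI : ∀ i, t i ∈ Set.Ioo (-1 : ℝ) 1) (ht : StrictMono t) :
    ∫ ω, ∏ i, Real.sign (f (t i) ω) ∂P =
      (2 / Real.pi) ^ n * pfaffian (Matrix.of fun i j => K22 (t i) (t j)) := by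
  induction n with
  | zero => rw [pfaffian_of_isEmpty]; simp
  | succ n ih =>
    change Fin (2 * n + 2) → ℝ at t
    let s : Fin (2 * n + 1) → ℝ := fun k => t k.succ
    have hs : StrictMono s := fun i j h => ht (Fin.succ_lt_succ_iff.2 h)
    have hsI : ∀ x ∈ Finset.univ.image s, x ∈ Set.Ioo (-1 : ℝ) 1 := by
      intro x hx
      obtain ⟨k, _, rfl⟩ := Finset.mem_image.1 hx
      exact hI _
    have hts : ∀ x ∈ Finset.univ.image s, t 0 < x := by
      intro x hx
      obtain ⟨k, _, rfl⟩ := Finset.mem_image.1 hx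
      exact ht (Fin.succ_pos k)
    have key := hf.signMean_expansion (hI 0) hsI hts
    rw [Finset.sum_image hs.injective.injOn] at key
    simp only [Finset.prod_image hs.injective.injOn] at key
    have e1 : ∫ ω, ∏ i : Fin (2 * (n + 1)), Real.sign (f (t i) ω) ∂P =
        ∫ ω, Real.sign (f (t 0) ω) * ∏ k, Real.sign (f (s k) ω) ∂P :=
      integral_congr_ae (ae_of_all _ fun ω =>
        Fin.prod_univ_succ fun i : Fin (2 * n + 2) => Real.sign (f (t i) ω))
    have e2 := pfaffian_succ (n := n) (Matrix.of fun i j => K22 (t i) (t j))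
    refine e1.trans (key.trans (Eq.trans ?_ (congrArg _ e2.symm)))
    rw [Finset.mul_sum]
    refine Finset.sum_congr rfl fun i _ => ?_
    have hsi : StrictMono fun k => s (i.succAbove k) :=
      hs.comp (Fin.strictMono_succAbove i)
    have e3 : (Finset.univ.image s).erase (s i) =
        Finset.univ.image fun k => s (i.succAbove k) := by
      ext x
      simp only [Finset.mem_erase, Finset.mem_image, Finset.mem_univ, true_and]
      constructor
      · rintro ⟨h1, j, rfl⟩
        obtain ⟨k, rfl⟩ := Fin.exists_succAbove_eq (x := j) (y := i) (fun h => h1 (h ▸ rfl))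
        exact ⟨k, rfl⟩
      · rintro ⟨k, rfl⟩
        exact ⟨hs.injective.ne (Fin.succAbove_ne i k), _, rfl⟩
    rw [signMean, e3, Finset.prod_image hsi.injective.injOn, prod_sign_succAbove hs]
    simp only [Finset.prod_image hsi.injective.injOn]
    rw [ih (t := fun k => s (i.succAbove k)) (fun k => hI _) hsi]
    have e4 : (Matrix.of fun i j : Fin (2 * n + 2) => K22 (t i) (t j)) 0 i.succ =
        Real.arcsin (corr (t 0) (s i)) := K22_of_lt (ht (Fin.succ_pos i))
    rw [e4]
    have e5 : dropPair (Matrix.of fun i j : Fin (2 * n + 2) => K22 (t i) (t j)) i =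
        Matrix.of fun k l => K22 (s (i.succAbove k)) (s (i.succAbove l)) := rfl
    rw [e5]
    ring

/-- The mean is symmetric in the points, so they may be sorted; the sign gained by the Pfaffian is
the product of the `sgn(t_j - t_i)`. -/
lemma signMean_of_injective (hf : IsSzegoField P f) {n : ℕ} {t : Fin (2 * n) → ℝ}
    (hI : ∀ i, t i ∈ Set.Ioo (-1 : ℝ) 1) (ht : Function.Injective t) :
    ∫ ω, ∏ i, Real.sign (f (t i) ω) ∂P =
      (2 / Real.pi) ^ n * (∏ i, ∏ j ∈ Finset.Ioi i, Real.sign (t j - t i)) *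
        pfaffian (Matrix.of fun i j => K22 (t i) (t j)) := by
  have hσ : StrictMono (t ∘ Tuple.sort t) :=
    (Tuple.monotone_sort t).strictMono_of_injective (ht.comp (Tuple.sort t).injective)
  have h1 := hf.signMean_of_strictMono (t := t ∘ Tuple.sort t) (fun i => hI (Tuple.sort t i)) hσ
  have h2 : ∀ ω, ∏ i, Real.sign (f ((t ∘ Tuple.sort t) i) ω) = ∏ i, Real.sign (f (t i) ω) :=
    fun ω => Equiv.prod_comp (Tuple.sort t) fun i => Real.sign (f (t i) ω)
  simp only [h2] at h1
  have h3 := pfaffian_submatrix_perm (B := Matrix.of fun i j => K22 (t i) (t j))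
    (fun i j => K22_skew _ _) (Tuple.sort t)
  rw [h1, prod_prod_sign_eq_sign_perm hσ, mul_assoc, ← h3]
  rfl

end IsSzegoField

end GaussianPowerSeries

end

open GaussianPowerSeries in
theorem theorem3 {Ω : Type*} [MeasurableSpace Ω] (P : Measure Ω) [IsProbabilityMeasure P]
    (a : ℕ → Ω → ℝ) (hindep : iIndepFun a P) (hlaw : ∀ k, HasLaw (a k) (gaussianReal 0 1) P) :
    (∀ᵐ ω ∂P, ∀ t ∈ Set.Ioo (-1 : ℝ) 1, Summable fun k : ℕ => a k ω * t ^ k) ∧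
    ∀ (n : ℕ) (t : Fin (2 * n) → ℝ), (∀ i, t i ∈ Set.Ioo (-1 : ℝ) 1) →
      (Function.Injective t →
        Integrable (fun ω => ∏ i, Real.sign (GaussianPowerSeries.powerSeries a ω (t i))) P ∧
        ∫ ω, ∏ i, Real.sign (GaussianPowerSeries.powerSeries a ω (t i)) ∂P
          = (2 / Real.pi) ^ n * (∏ i, ∏ j ∈ Finset.Ioi i, Real.sign (t j - t i))
            * GaussianPowerSeries.pfaffian
                (Matrix.of fun i j => GaussianPowerSeries.K22 (t i) (t j))) ∧
      (StrictMono t →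
        ∫ ω, ∏ i, Real.sign (GaussianPowerSeries.powerSeries a ω (t i)) ∂P
          = (2 / Real.pi) ^ n * GaussianPowerSeries.pfaffianUpper
              (fun i j => Real.arcsin (GaussianPowerSeries.corr (t i) (t j))) ∧
        ∫ ω, ∏ i, Real.sign (GaussianPowerSeries.powerSeries a ω (t i)) ∂P
          = GaussianPowerSeries.pfaffianUpper
              (fun i j => ∫ ω, Real.sign (GaussianPowerSeries.powerSeries a ω (t i))
                * Real.sign (GaussianPowerSeries.powerSeries a ω (t j)) ∂P)) := by
  refine ⟨?_, fun n t hI => ?_⟩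
  · filter_upwards [ae_summable_mul_pow hlaw] with ω hω t ht using summable_mul_pow hω ht
  obtain ⟨b, hab, hf⟩ := exists_version hindep hlaw
  have hps : ∀ᵐ ω ∂P, ∀ s, powerSeries b ω s = powerSeries a ω s := by
    filter_upwards [hab] with ω hω s
    simp only [powerSeries, hω]
  have hprod : (fun ω => ∏ i, Real.sign (powerSeries b ω (t i))) =ᵐ[P]
      fun ω => ∏ i, Real.sign (powerSeries a ω (t i)) := by
    filter_upwards [hps] with ω hω
    simp only [hω]
  refine ⟨fun ht => ⟨?_, ?_⟩, fun ht => ?_⟩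
  · refine Integrable.congr (Integrable.of_bound (C := 1) (Measurable.aestronglyMeasurable ?_)
      (ae_of_all _ fun _ => abs_prod_sign_le _ _)) hprod
    exact Finset.measurable_fun_prod _ fun i _ => measurable_sign.comp (hf.measurable _ (hI i))
  · rw [← integral_congr_ae hprod]
    exact hf.signMean_of_injective hI ht
  · have h := hf.signMean_of_strictMono hI ht
    rw [integral_congr_ae hprod] at h
    refine ⟨?_, ?_⟩
    · rw [h, pfaffianUpper, skewOfUpper_eq ht (c := 1) (fun i j _ => (one_mul _).symm), one_smul]
    -- The factor `(2/π) ^ n` is distributed over the entries; by the two-point case each entry is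
    -- then a pair correlation.
    · rw [h, pfaffianUpper, skewOfUpper_eq ht (c := 2 / Real.pi) (fun i j hij => ?_),
        pfaffian_smul]
      rw [← hf.signMean_pair (hI i) (hI j) (ht hij)]
      refine integral_congr_ae ?_
      filter_upwards [hps] with ω hω
      rw [hω, hω]
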